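/- Let $p$ be a prime, let $\mathbb{C}_p$ be the completion of an algebraic closure of $\mathbb{Q}_p$, and let $n\ge 0$. A subset $X\subseteq\mathbb{C}_p^n$ is called analytic if for every $x\in X$ there is a closed box $B$ around $x$ (a product of closed balls whose radii are norms of non-zero elements of $\mathbb{C}_p$) such that $X\cap B$ is the common zero set in $B$ of finitely many power series that are strictly convergent on $B$. The dimension $\dim X$ of a non-empty subset $X\subseteq\mathbb{C}_p^n$ is the largest integer $m\ge 0$ such that there is a $\mathbb{C}_p$-linear map $\ell:\mathbb{C}_p^n\to\mathbb{C}_p^m$ for which $\ell(X)$ has non-empty interior, and $\dim\emptyset=-\infty$. For $x\in X$ the local dimension $\dim_x X$ is the minimum of $\dim(X\cap B)$ over all open balls $B\subseteq\mathbb{C}_p^n$ containing $x$. Let $X,Y\subseteq\mathbb{C}_p^n$ be analytic and let $x\in X\cap Y$. Then $$\dim_x(X\cap Y)\ \ge\ \dim_x X+\dim_x Y-n .$$ In particular, if $\dim_x X=\dim X$ and $\dim_x Y=\dim Y$, then $$\dim_x(X\cap Y)\ \ge\ \dim X+\dim Y-n .$$ -/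

import Mathlib

namespace PadicAnalytic

/-- The closed box with centre `a` and radii `r`: a product of closed balls of `ℂ_[p]`. -/
def closedBox {p : ℕ} [Fact p.Prime] {n : ℕ} (a : Fin n → ℂ_[p]) (r : Fin n → ℝ) :
    Set (Fin n → ℂ_[p]) :=
  {y | ∀ i, ‖y i - a i‖ ≤ r i}

/-- The value at `y` of the power series `f` expanded around `a`. -/
noncomputable def evalAround {p : ℕ} [Fact p.Prime] {n : ℕ} (f : MvPowerSeries (Fin n) ℂ_[p])
    (a y : Fin n → ℂ_[p]) : ℂ_[p] :=
  ∑' t : Fin n →₀ ℕ, MvPowerSeries.coeff t f * ∏ i, (y i - a i) ^ t i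

/-- `X` is analytic: around every point `x` of `X` there is a closed box on which `X` is the common
zero locus of finitely many power series that converge strictly on that box (`IsRestricted r f`
says that the coefficients of `f`, rescaled to the box of radii `r`, tend to zero). The radii are
norms of non-zero scalars. -/
def IsAnalytic {p : ℕ} [Fact p.Prime] {n : ℕ} (X : Set (Fin n → ℂ_[p])) : Prop :=
  ∀ x ∈ X, ∃ c : Fin n → ℂ_[p], (∀ i, c i ≠ 0) ∧
    ∃ F : Finset (MvPowerSeries (Fin n) ℂ_[p]),
      (∀ f ∈ F, MvPowerSeries.IsRestricted (fun i => ‖c i‖) f) ∧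
      X ∩ closedBox x (fun i => ‖c i‖) =
        {y ∈ closedBox x (fun i => ‖c i‖) | ∀ f ∈ F, evalAround f x y = 0}

/-- The dimension of `X`: the largest `m` for which some linear map to the `m`-dimensional space
maps `X` onto a set with non-empty interior. It is `⊥` for the empty set. -/
noncomputable def dim {p : ℕ} [Fact p.Prime] {n : ℕ} (X : Set (Fin n → ℂ_[p])) : WithBot ℕ∞ :=
  ⨆ (m : ℕ) (_ : ∃ l : (Fin n → ℂ_[p]) →ₗ[ℂ_[p]] (Fin m → ℂ_[p]), (interior (l '' X)).Nonempty),
    (m : WithBot ℕ∞)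

/-- The local dimension of `X` at `x`: the minimum of the dimensions of `X ∩ B` over the open
balls `B` containing `x`. -/
noncomputable def localDim {p : ℕ} [Fact p.Prime] {n : ℕ} (X : Set (Fin n → ℂ_[p]))
    (x : Fin n → ℂ_[p]) : WithBot ℕ∞ :=
  ⨅ (c : Fin n → ℂ_[p]) (r : ℝ) (_ : x ∈ Metric.ball c r), dim (X ∩ Metric.ball c r)

end PadicAnalytic

/-! Translate `x` to the origin. Two facts about the germ of a zero locus carry the proof. Noether
normalization (`IsZeroLocusGerm.exists_finite_open_projection`) provides a linear map y to K^e that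
has the origin as an isolated zero on the germ and sends its neighbourhoods of 0 onto neighbourhoods
of 0. For the germ of X ∩ Y this gives e ≤ dim_x(X ∩ Y) by `le_localDim`. Conversely
(`IsZeroLocusGerm.exists_interior_image_eq_empty`), if the origin is an isolated zero on a germ of
some linear map to K^e, then a small piece of the germ has no linear image with interior in
dimension greater than e.

The two are joined by reduction to the diagonal. On X × Y the map (u, v) ↦ (y u, u - v) to K^(e+n)
vanishes only on the diagonal, at zeros of y on X ∩ Y, so the origin is isolated there. If l(X) and
l'(Y) have interior near x in dimensions a and b, then (l × l')(X × Y) has interior in dimension a +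
b, whence a + b ≤ e + n.

Both facts rest on eliminating one variable (`IsZeroLocusGerm.exists_projection`), by Weierstrass
preparation and resultants. Repeated elimination yields the projection y, and also shows that the
functions on a germ form a finite module over the functions of any y with an isolated zero
(`IsZeroLocusGerm.exists_generators`).

The converse fact is then a counting argument in the manner of Siegel's lemma
(`not_closedBall_subset_image`). With more than e functions there are so many monomials in them that
a normalized combination vanishes to high order in y, hence is tiny. If the functions filled a ball,
the Gauss norm would bound that combination from below. Convergent series enter only as uniform
limits of polynomials, controlled through `norm_mvCoeff_mul_pow_le`. -/

open Filter Topology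

namespace PadicAnalytic

/-! ### Coefficient bounds from the supremum norm on a ball -/

section Gauss
variable {K : Type*} [NontriviallyNormedField K] [IsUltrametricDist K]

/-- Two consecutive integers cannot both have norm less than 1, because they differ by 1. Such an
`m` serves as the order of a group of roots of unity over which one may average without loss of
norm. -/
theorem exists_natCast_norm_eq_one (D : ℕ) : ∃ m : ℕ, D < m ∧ ‖(m : K)‖ = 1 := by
  by_cases h : ‖((D + 1 : ℕ) : K)‖ = 1
  · exact ⟨D + 1, by omega, h⟩
  · refine ⟨D + 2, by omega, le_antisymm (IsUltrametricDist.norm_natCast_le_one K _) ?_⟩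
    have h1 : ‖((D + 1 : ℕ) : K)‖ < 1 :=
      lt_of_le_of_ne (IsUltrametricDist.norm_natCast_le_one K _) h
    have h2 : (1 : K) = ((D + 2 : ℕ) : K) - ((D + 1 : ℕ) : K) := by push_cast; ring
    have h3 := IsUltrametricDist.norm_add_le_max ((D + 2 : ℕ) : K) (-((D + 1 : ℕ) : K))
    rw [← sub_eq_add_neg, ← h2, norm_one, norm_neg] at h3
    rcases le_max_iff.1 h3 with h4 | h4
    · exact h4
    · linarith

variable [IsAlgClosed K]

/-- The coefficients of a polynomial are bounded by its supremum norm on a closed ball. -/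
theorem norm_coeff_mul_pow_le (P : Polynomial K) (c : K) {C : ℝ}
    (h : ∀ z, ‖z‖ ≤ ‖c‖ → ‖P.eval z‖ ≤ C) (i : ℕ) : ‖P.coeff i‖ * ‖c‖ ^ i ≤ C := by
  have hC : 0 ≤ C := (norm_nonneg _).trans (h c le_rfl)
  obtain ⟨m, hm, hm1⟩ := exists_natCast_norm_eq_one (K := K) (max P.natDegree i)
  have hm0 : (m : K) ≠ 0 := by
    intro h0; rw [h0, norm_zero] at hm1; exact zero_ne_one hm1
  have hPm : P.natDegree < m := (le_max_left _ _).trans_lt hm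
  have him : i < m := (le_max_right _ _).trans_lt hm
  have : NeZero (m : K) := ⟨hm0⟩
  have : NeZero m := ⟨by omega⟩
  obtain ⟨ζ, hζ⟩ := HasEnoughRootsOfUnity.exists_primitiveRoot K m
  have hζ0 : ζ ≠ 0 := hζ.ne_zero (by omega)
  have hζn : ‖ζ‖ = 1 := by
    have := congrArg norm hζ.pow_eq_one
    rw [norm_pow, norm_one] at this
    exact (pow_eq_one_iff_of_nonneg (norm_nonneg _) (by omega)).1 this
  -- Fourier inversion on the circle `c * ζ ^ j`. Since `m` exceeds both the degree and `i`,
  -- distinct exponents stay distinct modulo `m`.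
  have key : ∑ j ∈ Finset.range m, P.eval (c * ζ ^ j) * (ζ⁻¹ ^ i) ^ j
      = m * (P.coeff i * c ^ i) := by
    simp_rw [Polynomial.eval_eq_sum_range' hPm, Finset.sum_mul]
    rw [Finset.sum_comm]
    have : ∀ l ∈ Finset.range m, ∑ j ∈ Finset.range m,
        P.coeff l * (c * ζ ^ j) ^ l * (ζ⁻¹ ^ i) ^ j
        = if l = i then m * (P.coeff i * c ^ i) else 0 := by
      intro l hl
      have e : ∀ j, P.coeff l * (c * ζ ^ j) ^ l * (ζ⁻¹ ^ i) ^ j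
          = P.coeff l * c ^ l * (ζ ^ l * ζ⁻¹ ^ i) ^ j := by
        intro j; rw [mul_pow, mul_pow, ← pow_mul, ← pow_mul, mul_comm j l]; ring
      simp_rw [e, ← Finset.mul_sum]
      split_ifs with hli
      · subst hli
        have : ζ ^ l * ζ⁻¹ ^ l = 1 := by rw [← mul_pow, mul_inv_cancel₀ hζ0, one_pow]
        simp_rw [this, one_pow, Finset.sum_const, Finset.card_range, nsmul_eq_mul]
        ring
      · have hne : ζ ^ l * ζ⁻¹ ^ i ≠ 1 := by
          intro h1
          rw [inv_pow, mul_inv_eq_one₀ (pow_ne_zero _ hζ0)] at h1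
          exact hli (hζ.pow_inj (Finset.mem_range.1 hl) him h1)
        have h1 : (ζ ^ l * ζ⁻¹ ^ i) ^ m = 1 := by
          rw [mul_pow, ← pow_mul, ← pow_mul, mul_comm l, mul_comm i, pow_mul, pow_mul, inv_pow,
            hζ.pow_eq_one]; simp
        rw [geom_sum_eq hne, h1]; simp
    rw [Finset.sum_congr rfl this]
    simp [him]
  have hle : ‖∑ j ∈ Finset.range m, P.eval (c * ζ ^ j) * (ζ⁻¹ ^ i) ^ j‖ ≤ C := by
    refine IsUltrametricDist.norm_sum_le_of_forall_le_of_nonneg hC fun j _ => ?_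
    simp only [norm_mul, norm_pow, norm_inv, hζn]
    simpa using h (c * ζ ^ j) (by simp [hζn])
  rw [key] at hle
  simpa [hm1] using hle

/-- The coefficients of a polynomial in several variables are bounded by its supremum norm on a
closed ball. -/
theorem norm_mvCoeff_mul_pow_le {n : ℕ} (P : MvPolynomial (Fin n) K) (c : K) {C : ℝ}
    (h : ∀ x, ‖x‖ ≤ ‖c‖ → ‖MvPolynomial.eval x P‖ ≤ C) (t : Fin n →₀ ℕ) :
    ‖P.coeff t‖ * ‖c‖ ^ t.degree ≤ C := by
  induction n generalizing C with
  | zero =>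
    have h0 := h 0 (by rw [norm_zero]; exact norm_nonneg c)
    rw [Subsingleton.elim t 0]
    rw [MvPolynomial.eq_C_of_isEmpty P] at h0
    simpa using h0
  | succ n ih =>
    obtain ⟨i, s, rfl⟩ : ∃ i s, t = Finsupp.cons i s := ⟨t 0, t.tail, (Finsupp.cons_tail t).symm⟩
    -- The one-variable bound in the first coordinate, uniform in the others; the factor `c ^ i`
    -- absorbs the radius, so the induction hypothesis applies with the same `C`.
    have h1 : ∀ x : Fin n → K, ‖x‖ ≤ ‖c‖ →
        ‖MvPolynomial.eval x ((MvPolynomial.finSuccEquiv K n P).coeff i * MvPolynomial.C (c ^ i))‖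
          ≤ C := by
      intro x hx
      have := norm_coeff_mul_pow_le
        ((MvPolynomial.finSuccEquiv K n P).map (MvPolynomial.eval x)) c (C := C) (fun z hz => by
          rw [← MvPolynomial.eval_eq_eval_mv_eval']
          refine h _ ((pi_norm_le_iff_of_nonneg (norm_nonneg _)).2 fun j => ?_)
          refine Fin.cases hz (fun k => ?_) j
          simpa using (norm_le_pi_norm x k).trans hx) i
      simpa using this
    simp_rw [mul_comm _ (MvPolynomial.C (c ^ i))] at h1
    have h2 := ih _ h1 s
    rw [ MvPolynomial.coeff_C_mul, MvPolynomial.finSuccEquiv_coeff_coeff] at h2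
    have : (Finsupp.cons i s).degree = i + s.degree := by
      simp [Finsupp.degree_eq_sum, Fin.sum_univ_succ]
    rw [this, pow_add]
    rw [norm_mul, norm_pow] at h2
    linarith

end Gauss

/-! ### Uniform limits of polynomials and analytic germs -/

section Germs
variable {K : Type*} [NontriviallyNormedField K] {n : ℕ}

/-- `f` is a uniform limit of polynomial functions on `S`. -/
def IsPolyLimitOn (S : Set (Fin n → K)) (f : (Fin n → K) → K) : Prop :=
  ∀ ε > 0, ∃ P : MvPolynomial (Fin n) K, ∀ x ∈ S, ‖f x - MvPolynomial.eval x P‖ ≤ ε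

/-- `f` is a uniform limit of polynomial functions on some neighbourhood of the origin. Over an
algebraically closed complete ultrametric field these are the functions that are given by a
convergent power series near the origin. -/
def IsAnalyticGerm (f : (Fin n → K) → K) : Prop :=
  ∃ δ > 0, IsPolyLimitOn (Metric.closedBall 0 δ) f

theorem exists_norm_eval_le (P : MvPolynomial (Fin n) K) (R : ℝ) :
    ∃ C, 0 ≤ C ∧ ∀ x, ‖x‖ ≤ R → ‖MvPolynomial.eval x P‖ ≤ C := by
  induction P using MvPolynomial.induction_on with
  | C a => exact ⟨‖a‖, norm_nonneg _, fun x _ => by simp⟩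
  | add p q hp hq =>
    obtain ⟨C, hC, h⟩ := hp
    obtain ⟨D, hD, h'⟩ := hq
    refine ⟨C + D, by positivity, fun x hx => ?_⟩
    rw [map_add]
    exact (norm_add_le _ _).trans (add_le_add (h x hx) (h' x hx))
  | mul_X p i hp =>
    obtain ⟨C, hC, h⟩ := hp
    refine ⟨C * |R|, by positivity, fun x hx => ?_⟩
    rw [map_mul, norm_mul, MvPolynomial.eval_X]
    exact mul_le_mul (h x hx) (((norm_le_pi_norm x i).trans hx).trans (le_abs_self _))
      (norm_nonneg _) hC

/-- Polynomial functions are Lipschitz on bounded sets. -/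
theorem exists_norm_eval_sub_le (P : MvPolynomial (Fin n) K) (R : ℝ) :
    ∃ L, 0 ≤ L ∧ ∀ x y, ‖x‖ ≤ R → ‖y‖ ≤ R →
      ‖MvPolynomial.eval x P - MvPolynomial.eval y P‖ ≤ L * ‖x - y‖ := by
  induction P using MvPolynomial.induction_on with
  | C a => exact ⟨0, le_rfl, fun x y _ _ => by simp⟩
  | add p q hp hq =>
    obtain ⟨C, hC, h⟩ := hp
    obtain ⟨D, hD, h'⟩ := hq
    refine ⟨C + D, by positivity, fun x y hx hy => ?_⟩
    rw [map_add, map_add, add_sub_add_comm, add_mul]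
    exact (norm_add_le _ _).trans (add_le_add (h x y hx hy) (h' x y hx hy))
  | mul_X p i hp =>
    obtain ⟨L, hL, h⟩ := hp
    obtain ⟨C, hC, hb⟩ := exists_norm_eval_le p R
    refine ⟨L * |R| + C, by positivity, fun x y hx hy => ?_⟩
    have e : MvPolynomial.eval x (p * MvPolynomial.X i) - MvPolynomial.eval y (p * MvPolynomial.X i)
        = (MvPolynomial.eval x p - MvPolynomial.eval y p) * x i
          + MvPolynomial.eval y p * ((x - y) i) := by
      simp only [map_mul, MvPolynomial.eval_X, Pi.sub_apply]; ring
    rw [e]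
    refine (norm_add_le _ _).trans ?_
    rw [norm_mul, norm_mul, add_mul]
    have h1 : ‖x i‖ ≤ |R| := ((norm_le_pi_norm x i).trans hx).trans (le_abs_self _)
    have h2 := norm_le_pi_norm (x - y) i
    have h3 := h x y hx hy
    have h4 := hb y hy
    have h5 : ‖MvPolynomial.eval x p - MvPolynomial.eval y p‖ * ‖x i‖ ≤ (L * ‖x - y‖) * |R| :=
      mul_le_mul h3 h1 (norm_nonneg _) (by positivity)
    have h6 : ‖MvPolynomial.eval y p‖ * ‖(x - y) i‖ ≤ C * ‖x - y‖ :=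
      mul_le_mul h4 h2 (norm_nonneg _) hC
    linarith

namespace IsPolyLimitOn
variable {S T : Set (Fin n → K)} {f g : (Fin n → K) → K}

theorem mono (h : IsPolyLimitOn T f) (hST : S ⊆ T) : IsPolyLimitOn S f := fun ε hε => by
  obtain ⟨P, hP⟩ := h ε hε
  exact ⟨P, fun x hx => hP x (hST hx)⟩

theorem congr (h : IsPolyLimitOn S f) (hfg : ∀ x ∈ S, g x = f x) : IsPolyLimitOn S g :=
  fun ε hε => by
  obtain ⟨P, hP⟩ := h ε hε
  exact ⟨P, fun x hx => by rw [hfg x hx]; exact hP x hx⟩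

theorem eval (P : MvPolynomial (Fin n) K) : IsPolyLimitOn S fun x => MvPolynomial.eval x P :=
  fun ε hε => ⟨P, fun x _ => by simpa using hε.le⟩

theorem add (hf : IsPolyLimitOn S f) (hg : IsPolyLimitOn S g) :
    IsPolyLimitOn S fun x => f x + g x := fun ε hε => by
  obtain ⟨P, hP⟩ := hf (ε / 2) (by positivity)
  obtain ⟨Q, hQ⟩ := hg (ε / 2) (by positivity)
  refine ⟨P + Q, fun x hx => ?_⟩
  rw [map_add, add_sub_add_comm]
  linarith [norm_add_le (f x - MvPolynomial.eval x P) (g x - MvPolynomial.eval x Q), hP x hx,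
    hQ x hx]

theorem exists_norm_le (hf : IsPolyLimitOn S f) {R : ℝ} (hS : ∀ x ∈ S, ‖x‖ ≤ R) :
    ∃ C, 0 ≤ C ∧ ∀ x ∈ S, ‖f x‖ ≤ C := by
  obtain ⟨P, hP⟩ := hf 1 one_pos
  obtain ⟨C, hC, h⟩ := exists_norm_eval_le P R
  refine ⟨C + 1, by positivity, fun x hx => ?_⟩
  have := norm_add_le (f x - MvPolynomial.eval x P) (MvPolynomial.eval x P)
  rw [sub_add_cancel] at this
  linarith [hP x hx, h x (hS x hx)]

theorem mul (hf : IsPolyLimitOn S f) (hg : IsPolyLimitOn S g) {R : ℝ} (hS : ∀ x ∈ S, ‖x‖ ≤ R) :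
    IsPolyLimitOn S fun x => f x * g x := fun ε hε => by
  obtain ⟨C, hC, hfC⟩ := hf.exists_norm_le hS
  obtain ⟨Q, hQ⟩ := hg (ε / 2 / (C + 1)) (by positivity)
  obtain ⟨D, hD, hQD⟩ := exists_norm_eval_le Q R
  obtain ⟨P, hP⟩ := hf (ε / 2 / (D + 1)) (by positivity)
  refine ⟨P * Q, fun x hx => ?_⟩
  have e : f x * g x - MvPolynomial.eval x (P * Q) = f x * (g x - MvPolynomial.eval x Q)
      + (f x - MvPolynomial.eval x P) * MvPolynomial.eval x Q := by rw [map_mul]; ring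
  rw [e]
  refine (norm_add_le _ _).trans ?_
  rw [norm_mul, norm_mul]
  have h1 : ‖f x‖ * ‖g x - MvPolynomial.eval x Q‖ ≤ (C + 1) * (ε / 2 / (C + 1)) :=
    mul_le_mul ((hfC x hx).trans (by linarith)) (hQ x hx) (norm_nonneg _) (by positivity)
  have h2 : ‖f x - MvPolynomial.eval x P‖ * ‖MvPolynomial.eval x Q‖
      ≤ (ε / 2 / (D + 1)) * (D + 1) :=
    mul_le_mul (hP x hx) ((hQD x (hS x hx)).trans (by linarith)) (norm_nonneg _) (by positivity)
  rw [mul_div_cancel₀ _ (by positivity)] at h1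
  rw [div_mul_cancel₀ _ (by positivity)] at h2
  linarith

theorem continuousOn (hf : IsPolyLimitOn S f) : ContinuousOn f S := by
  refine continuousOn_of_uniform_approx_of_continuousOn fun u hu => ?_
  obtain ⟨ε, hε, h⟩ := Metric.mem_uniformity_dist.1 hu
  obtain ⟨P, hP⟩ := hf (ε / 2) (by positivity)
  refine ⟨fun x => MvPolynomial.eval x P, (MvPolynomial.continuous_eval P).continuousOn,
    fun x hx => h ?_⟩
  rw [dist_eq_norm]
  linarith [hP x hx]

theorem comp_linear (h : IsPolyLimitOn S f) {m : ℕ} (l : (Fin m → K) →ₗ[K] (Fin n → K)) :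
    IsPolyLimitOn (l ⁻¹' S) fun x => f (l x) := fun ε hε => by
  obtain ⟨P, hP⟩ := h ε hε
  refine ⟨MvPolynomial.bind₁
    (fun i => ∑ j, MvPolynomial.X j * MvPolynomial.C (l (Pi.single j 1) i)) P, fun x hx => ?_⟩
  have e : MvPolynomial.eval x (MvPolynomial.bind₁
      (fun i => ∑ j, MvPolynomial.X j * MvPolynomial.C (l (Pi.single j 1) i)) P)
      = MvPolynomial.eval (l x) P := by
    rw [MvPolynomial.eval, MvPolynomial.eval₂Hom_bind₁]
    congr 2
    ext i
    rw [LinearMap.pi_apply_eq_sum_univ l x]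
    simp only [map_sum, map_mul, Finset.sum_apply, Pi.smul_apply, smul_eq_mul,
      MvPolynomial.eval₂Hom_X', MvPolynomial.coe_eval₂Hom, MvPolynomial.eval₂_C, RingHom.id_apply]
    refine Finset.sum_congr rfl fun j _ => ?_
    have : (Pi.single j 1 : Fin m → K) = fun k => if j = k then 1 else 0 := by
      ext k
      simp [Pi.single_apply, eq_comm]
    rw [this]
  rw [e]
  exact hP _ hx

theorem sum {ι : Type*} (s : Finset ι) {F : ι → (Fin n → K) → K}
    (h : ∀ i ∈ s, IsPolyLimitOn S (F i)) : IsPolyLimitOn S fun x => ∑ i ∈ s, F i x := by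
  classical
  induction s using Finset.induction_on with
  | empty => simpa using eval (S := S) (0 : MvPolynomial (Fin n) K)
  | insert a s ha ih =>
    simp_rw [Finset.sum_insert ha]
    exact (h a (Finset.mem_insert_self _ _)).add
      (ih fun i hi => h i (Finset.mem_insert_of_mem hi))

theorem const_mul (h : IsPolyLimitOn S f) (r : K) : IsPolyLimitOn S fun x => r * f x :=
  fun ε hε => by
  obtain ⟨P, hP⟩ := h (ε / (‖r‖ + 1)) (by positivity)
  refine ⟨MvPolynomial.C r * P, fun x hx => ?_⟩
  rw [map_mul, MvPolynomial.eval_C, ← mul_sub, norm_mul]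
  refine (mul_le_mul_of_nonneg_left (hP x hx) (norm_nonneg r)).trans ?_
  rw [mul_div_assoc', div_le_iff₀ (by positivity)]
  nlinarith [norm_nonneg r]

end IsPolyLimitOn

namespace IsAnalyticGerm
variable {f g : (Fin n → K) → K}

theorem eval (P : MvPolynomial (Fin n) K) : IsAnalyticGerm fun x => MvPolynomial.eval x P :=
  ⟨1, one_pos, .eval P⟩

theorem const (a : K) : IsAnalyticGerm fun _ : Fin n → K => a := by
  simpa using eval (n := n) (MvPolynomial.C a)

theorem coord (i : Fin n) : IsAnalyticGerm fun x : Fin n → K => x i := by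
  simpa using eval (MvPolynomial.X (R := K) i)

theorem exists_common (hf : IsAnalyticGerm f) (hg : IsAnalyticGerm g) :
    ∃ δ > 0, IsPolyLimitOn (Metric.closedBall 0 δ) f ∧ IsPolyLimitOn (Metric.closedBall 0 δ) g := by
  obtain ⟨δ, hδ, h⟩ := hf
  obtain ⟨δ', hδ', h'⟩ := hg
  exact ⟨min δ δ', lt_min hδ hδ', h.mono (Metric.closedBall_subset_closedBall (min_le_left _ _)),
    h'.mono (Metric.closedBall_subset_closedBall (min_le_right _ _))⟩

theorem add (hf : IsAnalyticGerm f) (hg : IsAnalyticGerm g) :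
    IsAnalyticGerm fun x => f x + g x := by
  obtain ⟨δ, hδ, h, h'⟩ := hf.exists_common hg
  exact ⟨δ, hδ, h.add h'⟩

theorem mul (hf : IsAnalyticGerm f) (hg : IsAnalyticGerm g) :
    IsAnalyticGerm fun x => f x * g x := by
  obtain ⟨δ, hδ, h, h'⟩ := hf.exists_common hg
  exact ⟨δ, hδ, h.mul h' fun x hx => mem_closedBall_zero_iff.1 hx⟩

theorem neg (hf : IsAnalyticGerm f) : IsAnalyticGerm fun x => - f x := by
  simpa using (const (-1)).mul hf

theorem sum {ι : Type*} (s : Finset ι) {F : ι → (Fin n → K) → K}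
    (h : ∀ i ∈ s, IsAnalyticGerm (F i)) : IsAnalyticGerm fun x => ∑ i ∈ s, F i x := by
  classical
  induction s using Finset.induction_on with
  | empty => simpa using const 0
  | insert a s ha ih =>
    simp_rw [Finset.sum_insert ha]
    exact (h a (Finset.mem_insert_self _ _)).add
      (ih fun i hi => h i (Finset.mem_insert_of_mem hi))

theorem prod {ι : Type*} (s : Finset ι) {F : ι → (Fin n → K) → K}
    (h : ∀ i ∈ s, IsAnalyticGerm (F i)) : IsAnalyticGerm fun x => ∏ i ∈ s, F i x := by
  classical
  induction s using Finset.induction_on with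
  | empty => simpa using const 1
  | insert a s ha ih =>
    simp_rw [Finset.prod_insert ha]
    exact (h a (Finset.mem_insert_self _ _)).mul
      (ih fun i hi => h i (Finset.mem_insert_of_mem hi))

theorem pow (hf : IsAnalyticGerm f) (k : ℕ) : IsAnalyticGerm fun x => f x ^ k := by
  simpa using prod (Finset.range k) fun _ _ => hf

theorem det {ι : Type*} [Fintype ι] [DecidableEq ι] {M : (Fin n → K) → Matrix ι ι K}
    (h : ∀ i j, IsAnalyticGerm fun x => M x i j) : IsAnalyticGerm fun x => (M x).det := by
  simp_rw [Matrix.det_apply']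
  exact sum _ fun σ _ => (const _).mul (prod _ fun i _ => h _ _)

theorem continuousAt (hf : IsAnalyticGerm f) : ContinuousAt f 0 := by
  obtain ⟨δ, hδ, h⟩ := hf
  exact h.continuousOn.continuousAt (Metric.closedBall_mem_nhds _ hδ)

theorem comp_linear (hf : IsAnalyticGerm f) {m : ℕ} (l : (Fin m → K) →ₗ[K] (Fin n → K)) :
    IsAnalyticGerm fun x => f (l x) := by
  obtain ⟨δ, hδ, h⟩ := hf
  have h1 : ∀ᶠ x in 𝓝 0, l x ∈ Metric.closedBall 0 δ :=
    (l.continuous_on_pi.tendsto' 0 0 (map_zero l)).eventually (Metric.closedBall_mem_nhds _ hδ)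
  obtain ⟨δ', hδ', h2⟩ := Metric.nhds_basis_closedBall.eventually_iff.1 h1
  exact ⟨δ', hδ', (h.comp_linear l).mono h2⟩

theorem exists_norm_le (hf : IsAnalyticGerm f) : ∃ C, 0 ≤ C ∧ ∀ᶠ x in 𝓝 0, ‖f x‖ ≤ C := by
  obtain ⟨δ, hδ, h⟩ := hf
  obtain ⟨C, hC, hb⟩ := h.exists_norm_le fun x hx => mem_closedBall_zero_iff.1 hx
  exact ⟨C, hC, Filter.mem_of_superset (Metric.closedBall_mem_nhds _ hδ) hb⟩

end IsAnalyticGerm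

end Germs

/-! ### Taylor coefficients of uniform limits, and leading terms -/

section Coeffs
variable {K : Type*} [NontriviallyNormedField K] {n : ℕ}

/-- On the closed ball of radius `‖c‖` the function `φ` is a uniform limit of polynomials whose
coefficients converge to `a`, in the norm that is rescaled to this ball. -/
def HasCoeffs (c : K) (φ : (Fin n → K) → K) (a : (Fin n →₀ ℕ) → K) : Prop :=
  ∀ ε > 0, ∃ P : MvPolynomial (Fin n) K,
    (∀ x, ‖x‖ ≤ ‖c‖ → ‖φ x - MvPolynomial.eval x P‖ ≤ ε) ∧
    ∀ t, ‖a t - P.coeff t‖ * ‖c‖ ^ t.degree ≤ ε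

namespace HasCoeffs
variable {c : K} {φ ψ : (Fin n → K) → K} {a b : (Fin n →₀ ℕ) → K}

theorem eval (P : MvPolynomial (Fin n) K) :
    HasCoeffs c (fun x => MvPolynomial.eval x P) fun t => P.coeff t :=
  fun ε hε => ⟨P, fun x _ => by simpa using hε.le, fun t => by simpa using hε.le⟩

theorem add (h : HasCoeffs c φ a) (h' : HasCoeffs c ψ b) :
    HasCoeffs c (fun x => φ x + ψ x) fun t => a t + b t := fun ε hε => by
  obtain ⟨P, hP, hPa⟩ := h (ε / 2) (by positivity)
  obtain ⟨Q, hQ, hQb⟩ := h' (ε / 2) (by positivity)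
  refine ⟨P + Q, fun x hx => ?_, fun t => ?_⟩
  · rw [map_add, add_sub_add_comm]
    linarith [norm_add_le (φ x - MvPolynomial.eval x P) (ψ x - MvPolynomial.eval x Q), hP x hx,
      hQ x hx]
  · rw [MvPolynomial.coeff_add, add_sub_add_comm]
    have := mul_le_mul_of_nonneg_right (norm_add_le (a t - P.coeff t) (b t - Q.coeff t))
      (pow_nonneg (norm_nonneg c) t.degree)
    rw [add_mul] at this
    linarith [hPa t, hQb t]

theorem const_mul (h : HasCoeffs c φ a) (r : K) :
    HasCoeffs c (fun x => r * φ x) fun t => r * a t := fun ε hε => by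
  obtain ⟨P, hP, hPa⟩ := h (ε / (‖r‖ + 1)) (by positivity)
  have hr : ‖r‖ * (ε / (‖r‖ + 1)) ≤ ε := by
    rw [mul_div_assoc', div_le_iff₀ (by positivity)]
    nlinarith [norm_nonneg r]
  refine ⟨MvPolynomial.C r * P, fun x hx => ?_, fun t => ?_⟩
  · rw [map_mul, MvPolynomial.eval_C, ← mul_sub, norm_mul]
    exact (mul_le_mul_of_nonneg_left (hP x hx) (norm_nonneg r)).trans hr
  · rw [MvPolynomial.coeff_C_mul, ← mul_sub, norm_mul, mul_assoc]
    exact (mul_le_mul_of_nonneg_left (hPa t) (norm_nonneg r)).trans hr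

theorem sum {ι : Type*} (s : Finset ι) {φ : ι → (Fin n → K) → K} {a : ι → (Fin n →₀ ℕ) → K}
    (h : ∀ i ∈ s, HasCoeffs c (φ i) (a i)) :
    HasCoeffs c (fun x => ∑ i ∈ s, φ i x) fun t => ∑ i ∈ s, a i t := by
  classical
  induction s using Finset.induction_on with
  | empty => simpa using eval (c := c) (0 : MvPolynomial (Fin n) K)
  | insert i s hi ih =>
    simp_rw [Finset.sum_insert hi]
    exact (h i (Finset.mem_insert_self _ _)).add
      (ih fun i hi => h i (Finset.mem_insert_of_mem hi))

end HasCoeffs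

theorem norm_prod_pow_le (x : Fin n → K) (t : Fin n →₀ ℕ) :
    ‖∏ i, x i ^ t i‖ ≤ ‖x‖ ^ t.degree := by
  rw [norm_prod, Finsupp.degree_eq_sum, ← Finset.prod_pow_eq_pow_sum]
  refine Finset.prod_le_prod (fun _ _ => norm_nonneg _) fun i _ => ?_
  rw [norm_pow]
  exact pow_le_pow_left₀ (norm_nonneg _) (norm_le_pi_norm x i) _

variable [IsUltrametricDist K] [IsAlgClosed K]

/-- The Gauss bound applied to differences of approximating polynomials makes each coefficient a
Cauchy sequence, at a rate uniform in the rescaled norm. -/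
theorem IsPolyLimitOn.exists_hasCoeffs [CompleteSpace K] {c : K} (hc : c ≠ 0)
    {φ : (Fin n → K) → K} (h : IsPolyLimitOn (Metric.closedBall 0 ‖c‖) φ) :
    ∃ a, HasCoeffs c φ a := by
  choose P hP using fun k : ℕ => h ((1 / 2) ^ k) (by positivity)
  have hd : ∀ k l t, ‖(P k).coeff t - (P l).coeff t‖ * ‖c‖ ^ t.degree
      ≤ (1 / 2) ^ k + (1 / 2) ^ l := by
    intro k l t
    rw [← MvPolynomial.coeff_sub]
    refine norm_mvCoeff_mul_pow_le _ c (fun x hx => ?_) t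
    have h1 := hP k x (mem_closedBall_zero_iff.2 hx)
    have h2 := hP l x (mem_closedBall_zero_iff.2 hx)
    have e : MvPolynomial.eval x (P k - P l)
        = (φ x - MvPolynomial.eval x (P l)) - (φ x - MvPolynomial.eval x (P k)) := by
      rw [map_sub]; ring
    rw [e]
    linarith [norm_sub_le (φ x - MvPolynomial.eval x (P l)) (φ x - MvPolynomial.eval x (P k))]
  have h0 : Tendsto (fun k : ℕ => (1 / 2 : ℝ) ^ k) atTop (𝓝 0) :=
    tendsto_pow_atTop_nhds_zero_of_lt_one (by norm_num) (by norm_num)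
  have hcp : ∀ t : Fin n →₀ ℕ, 0 < ‖c‖ ^ t.degree := fun t => pow_pos (norm_pos_iff.2 hc) _
  have hlim : ∀ t, ∃ b, Tendsto (fun k => (P k).coeff t) atTop (𝓝 b) := by
    intro t
    refine cauchySeq_tendsto_of_complete (cauchySeq_of_le_tendsto_0
      (fun N => ((1 / 2 : ℝ) ^ N + (1 / 2) ^ N) / ‖c‖ ^ t.degree) (fun k l N hk hl => ?_) ?_)
    · rw [dist_eq_norm, le_div_iff₀ (hcp t)]
      refine (hd k l t).trans (add_le_add ?_ ?_)
      · exact pow_le_pow_of_le_one (by norm_num) (by norm_num) hk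
      · exact pow_le_pow_of_le_one (by norm_num) (by norm_num) hl
    · simpa using (h0.add h0).div_const (‖c‖ ^ t.degree)
  choose a ha using hlim
  refine ⟨a, fun ε hε => ?_⟩
  obtain ⟨k, hk⟩ := ((h0.eventually (gt_mem_nhds hε))).exists
  refine ⟨P k, fun x hx => (hP k x (mem_closedBall_zero_iff.2 hx)).trans hk.le, fun t => ?_⟩
  have h1 : Tendsto (fun l => ‖(P l).coeff t - (P k).coeff t‖ * ‖c‖ ^ t.degree) atTop
      (𝓝 (‖a t - (P k).coeff t‖ * ‖c‖ ^ t.degree)) :=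
    ((ha t).sub_const _).norm.mul_const _
  have h2 : Tendsto (fun l : ℕ => (1 / 2 : ℝ) ^ l + (1 / 2) ^ k) atTop (𝓝 (0 + (1 / 2) ^ k)) :=
    h0.add_const _
  have := le_of_tendsto_of_tendsto' h1 h2 fun l => hd l k t
  linarith

/-- A function without terms of degree less than `k` is small near the origin. -/
theorem HasCoeffs.norm_le_mul_pow {c : K} {φ : (Fin n → K) → K} {a : (Fin n →₀ ℕ) → K}
    (h : HasCoeffs c φ a) {C : ℝ} (hC : ∀ x, ‖x‖ ≤ ‖c‖ → ‖φ x‖ ≤ C) {k : ℕ}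
    (hk : ∀ t, t.degree < k → a t = 0) {q : ℝ} (hq : 0 ≤ q) (hq1 : q ≤ 1) {x : Fin n → K}
    (hx : ‖x‖ ≤ q * ‖c‖) : ‖φ x‖ ≤ C * q ^ k := by
  have hC0 : 0 ≤ C := (norm_nonneg _).trans (hC 0 (by rw [norm_zero]; exact norm_nonneg c))
  refine le_of_forall_pos_le_add fun η hη => ?_
  obtain ⟨P, hP, hPa⟩ := h (η / 3) (by positivity)
  set ε := η / 3 with hε
  have hε0 : 0 < ε := by positivity
  have hqk0 : 0 ≤ q ^ k := pow_nonneg hq k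
  have hqk1 : q ^ k ≤ 1 := pow_le_one₀ hq hq1
  have hxc : ‖x‖ ≤ ‖c‖ := hx.trans (mul_le_of_le_one_left (norm_nonneg _) hq1)
  have hPC : ∀ y, ‖y‖ ≤ ‖c‖ → ‖MvPolynomial.eval y P‖ ≤ C + ε := fun y hy => by
    have := norm_sub_le (φ y) (φ y - MvPolynomial.eval y P)
    rw [sub_sub_cancel] at this
    linarith [hC y hy, hP y hy]
  have hterm : ‖MvPolynomial.eval x P‖ ≤ (C + ε) * q ^ k + ε := by
    rw [MvPolynomial.eval_eq']
    refine IsUltrametricDist.norm_sum_le_of_forall_le_of_nonneg (by positivity) fun t _ => ?_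
    rw [norm_mul]
    have h1 := mul_le_mul_of_nonneg_left (norm_prod_pow_le x t) (norm_nonneg (P.coeff t))
    -- Below degree `k` a coefficient of `P` is pure approximation error; from degree `k` on, the
    -- Gauss bound gains the factor `q ^ k`.
    rcases lt_or_ge t.degree k with ht | ht
    · have h2 := hPa t
      rw [hk t ht, zero_sub, norm_neg] at h2
      have h3 := mul_le_mul_of_nonneg_left (pow_le_pow_left₀ (norm_nonneg x) hxc t.degree)
        (norm_nonneg (P.coeff t))
      have : 0 ≤ (C + ε) * q ^ k := by positivity
      linarith
    · have h2 := norm_mvCoeff_mul_pow_le P c hPC t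
      have h3 := mul_le_mul_of_nonneg_left (pow_le_pow_left₀ (norm_nonneg x) hx t.degree)
        (norm_nonneg (P.coeff t))
      have h4 : ‖P.coeff t‖ * (q * ‖c‖) ^ t.degree ≤ (C + ε) * q ^ k := by
        rw [mul_pow, mul_comm (q ^ _), ← mul_assoc]
        exact mul_le_mul h2 (pow_le_pow_of_le_one hq hq1 ht) (by positivity) (by positivity)
      linarith
  have := norm_add_le (φ x - MvPolynomial.eval x P) (MvPolynomial.eval x P)
  rw [sub_add_cancel] at this
  have h5 := hP x hxc
  have h6 : ε * q ^ k ≤ ε := mul_le_of_le_one_right hε0.le hqk1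
  have h7 : (C + ε) * q ^ k = C * q ^ k + ε * q ^ k := by ring
  linarith

/-- An analytic function of one variable vanishes near the origin or has a leading term there. -/
theorem IsPolyLimitOn.eq_zero_or_exists_leadingTerm [CompleteSpace K] {c : K} (hc : c ≠ 0)
    {φ : (Fin 1 → K) → K} (h : IsPolyLimitOn (Metric.closedBall 0 ‖c‖) φ) :
    (∀ x, ‖x‖ ≤ 1 / 2 * ‖c‖ → φ x = 0) ∨
    ∃ (d : ℕ) (a : K) (C : ℝ), a ≠ 0 ∧ 0 ≤ C ∧
      ∀ x, ‖x‖ ≤ ‖c‖ → ‖φ x - a * x 0 ^ d‖ ≤ C * ‖x‖ ^ (d + 1) := by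
  obtain ⟨a, ha⟩ := h.exists_hasCoeffs hc
  have hcp : 0 < ‖c‖ := norm_pos_iff.2 hc
  have hsing : ∀ t : Fin 1 →₀ ℕ, t = Finsupp.single 0 (t.degree) := by
    refine fun t => Finsupp.ext fun i => ?_
    rw [Subsingleton.elim i 0]
    simp [Finsupp.degree_eq_sum]
  classical
  by_cases hz : ∃ k, a (Finsupp.single 0 k) ≠ 0
  · right
    set d := Nat.find hz with hd
    set P : MvPolynomial (Fin 1) K :=
      MvPolynomial.monomial (Finsupp.single 0 d) (-a (Finsupp.single 0 d)) with hP
    have hPe : ∀ x, φ x - a (Finsupp.single 0 d) * x 0 ^ d = φ x + MvPolynomial.eval x P := by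
      intro x
      simp [hP, MvPolynomial.eval_monomial, sub_eq_add_neg]
    have hψ := ha.add (.eval P)
    obtain ⟨C, hC0, hC⟩ := (h.add (.eval P)).exists_norm_le
      fun x hx => mem_closedBall_zero_iff.1 hx
    refine ⟨d, a (Finsupp.single 0 d), C / ‖c‖ ^ (d + 1), Nat.find_spec hz, by positivity,
      fun x hx => ?_⟩
    rw [hPe]
    -- Once the leading term is removed no term of degree at most `d` remains; the scale `q = ‖x‖ /
    -- ‖c‖` turns the estimate into one by `‖x‖ ^ (d + 1)`.
    have h1 := hψ.norm_le_mul_pow (fun x hx => hC x (mem_closedBall_zero_iff.2 hx)) (k := d + 1)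
      (fun t ht => ?_) (q := ‖x‖ / ‖c‖) (by positivity) ((div_le_one hcp).2 hx)
      (x := x) (by rw [div_mul_cancel₀ _ hcp.ne'])
    · rw [div_pow] at h1
      calc _ ≤ _ := h1
        _ = _ := by ring
    · rw [hsing t, hP, MvPolynomial.coeff_monomial]
      rcases (Nat.lt_succ_iff_lt_or_eq.1 ht) with h2 | h2
      · rw [if_neg, add_zero]
        · exact not_not.1 (Nat.find_min hz h2)
        · intro h3
          have := congrArg Finsupp.degree h3
          simp at this
          omega
      · rw [h2]; simp
  · left
    push Not at hz
    intro x hx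
    obtain ⟨C, hC0, hC⟩ := h.exists_norm_le fun x hx => mem_closedBall_zero_iff.1 hx
    -- All coefficients vanish, so the estimate holds for every order `k`.
    have h1 : ∀ k : ℕ, ‖φ x‖ ≤ C * (1 / 2) ^ k := fun k =>
      ha.norm_le_mul_pow (fun x hx => hC x (mem_closedBall_zero_iff.2 hx))
        (fun t _ => by rw [hsing t]; exact hz _) (by norm_num) (by norm_num) hx
    have h0 : Tendsto (fun k : ℕ => C * (1 / 2 : ℝ) ^ k) atTop (𝓝 (C * 0)) :=
      (tendsto_pow_atTop_nhds_zero_of_lt_one (by norm_num) (by norm_num)).const_mul C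
    have := ge_of_tendsto' h0 h1
    rw [mul_zero] at this
    exact norm_le_zero_iff.1 this

end Coeffs

/-! ### Weierstrass division -/

section Division
variable {K : Type*} [NontriviallyNormedField K] {n : ℕ}

theorem exists_isPolyLimitOn_of_norm_le [CompleteSpace K] {S : Set (Fin n → K)}
    {P : ℕ → MvPolynomial (Fin n) K} {C : ℝ}
    (h : ∀ k, ∀ x ∈ S, ‖MvPolynomial.eval x (P k)‖ ≤ C * (1 / 2) ^ k) :
    ∃ φ, IsPolyLimitOn S φ ∧ ∀ x ∈ S,
      Tendsto (fun N => ∑ k ∈ Finset.range N, MvPolynomial.eval x (P k)) atTop (𝓝 (φ x)) := by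
  have hdist : ∀ x ∈ S, ∀ N, dist (∑ k ∈ Finset.range N, MvPolynomial.eval x (P k))
      (∑ k ∈ Finset.range (N + 1), MvPolynomial.eval x (P k)) ≤ 2 * C / 2 / 2 ^ N := by
    intro x hx N
    rw [Finset.sum_range_succ, dist_self_add_right]
    refine (h N x hx).trans (le_of_eq ?_)
    rw [one_div, inv_pow]; field_simp
  have hlim : ∀ x, ∃ b, x ∈ S →
      Tendsto (fun N => ∑ k ∈ Finset.range N, MvPolynomial.eval x (P k)) atTop (𝓝 b) := by
    intro x
    by_cases hx : x ∈ S
    · obtain ⟨b, hb⟩ := cauchySeq_tendsto_of_complete (cauchySeq_of_le_geometric_two (hdist x hx))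
      exact ⟨b, fun _ => hb⟩
    · exact ⟨0, fun h => absurd h hx⟩
  choose φ hφ using hlim
  refine ⟨φ, fun ε hε => ?_, hφ⟩
  have h0 : Tendsto (fun N : ℕ => 2 * C * (1 / 2 : ℝ) ^ N) atTop (𝓝 (2 * C * 0)) :=
    (tendsto_pow_atTop_nhds_zero_of_lt_one (by norm_num) (by norm_num)).const_mul _
  rw [mul_zero] at h0
  obtain ⟨N, hN⟩ := (h0.eventually (gt_mem_nhds hε)).exists
  refine ⟨∑ k ∈ Finset.range N, P k, fun x hx => ?_⟩
  have := dist_le_of_le_geometric_two_of_tendsto (hdist x hx) (hφ x hx) N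
  rw [map_sum, ← dist_eq_norm, dist_comm]
  refine this.trans (le_trans (le_of_eq ?_) hN.le)
  rw [one_div, inv_pow]; field_simp

/-- The product of a closed disc in the first coordinate and a closed ball in the others. -/
def cylinder (K : Type*) [NontriviallyNormedField K] (n : ℕ) (δ ρ : ℝ) : Set (Fin (n + 1) → K) :=
  {y | ‖y 0‖ ≤ δ ∧ ‖Fin.tail y‖ ≤ ρ}

theorem norm_le_of_mem_cylinder {δ ρ : ℝ} {y : Fin (n + 1) → K} (hy : y ∈ cylinder K n δ ρ) :
    ‖y‖ ≤ max δ ρ := by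
  refine (pi_norm_le_iff_of_nonneg ((norm_nonneg _).trans (hy.1.trans (le_max_left _ _)))).2 ?_
  exact Fin.cases (hy.1.trans (le_max_left _ _))
    fun i => ((norm_le_pi_norm (Fin.tail y) i).trans hy.2).trans (le_max_right _ _)

theorem cylinder_subset_closedBall {δ ρ ε : ℝ} (hδ : δ ≤ ε) (hρ : ρ ≤ ε) :
    cylinder K n δ ρ ⊆ Metric.closedBall 0 ε := fun _ hy =>
  mem_closedBall_zero_iff.2 ((norm_le_of_mem_cylinder hy).trans (max_le hδ hρ))

theorem tail_continuous : Continuous (Fin.tail : (Fin (n + 1) → K) → Fin n → K) :=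
  continuous_pi fun i => continuous_apply i.succ

theorem cylinder_mem_nhds {δ ρ : ℝ} (hδ : 0 < δ) (hρ : 0 < ρ) : cylinder K n δ ρ ∈ 𝓝 0 := by
  have h1 : ∀ᶠ y : Fin (n + 1) → K in 𝓝 0, y 0 ∈ Metric.closedBall 0 δ :=
    ((continuous_apply 0).tendsto' 0 0 rfl).eventually (Metric.closedBall_mem_nhds _ hδ)
  have h2 : ∀ᶠ y : Fin (n + 1) → K in 𝓝 0, Fin.tail y ∈ Metric.closedBall 0 ρ :=
    (tail_continuous.tendsto' 0 0 rfl).eventually (Metric.closedBall_mem_nhds _ hρ)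
  filter_upwards [h1, h2] with y hy1 hy2
  exact ⟨mem_closedBall_zero_iff.1 hy1, mem_closedBall_zero_iff.1 hy2⟩

variable [IsUltrametricDist K] [IsAlgClosed K]

/-- A polynomial approximation of `g` is divided by `y 0 ^ d` in place of `f`. The Gauss bound in
the first variable controls quotient and remainders, and replacing `y 0 ^ d` by `f` costs at most `C
/ ‖c‖ ^ d` times `1 / 2 * ‖c‖ ^ d`. -/
theorem exists_division_step {c : K} (hc : c ≠ 0) {ρ : ℝ} {d : ℕ}
    {f : (Fin (n + 1) → K) → K}
    (hfd : ∀ y ∈ cylinder K n ‖c‖ ρ, ‖f y - y 0 ^ d‖ ≤ 1 / 2 * ‖c‖ ^ d)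
    {g : (Fin (n + 1) → K) → K} (hg : IsPolyLimitOn (cylinder K n ‖c‖ ρ) g) {C : ℝ} (hC : 0 < C)
    (hgC : ∀ y ∈ cylinder K n ‖c‖ ρ, ‖g y‖ ≤ C) :
    ∃ (Q : MvPolynomial (Fin (n + 1)) K) (R : ℕ → MvPolynomial (Fin n) K),
      (∀ y ∈ cylinder K n ‖c‖ ρ, ‖MvPolynomial.eval y Q‖ ≤ C / ‖c‖ ^ d) ∧
      (∀ i, ∀ x ∈ Metric.closedBall 0 ρ, ‖MvPolynomial.eval x (R i)‖ ≤ C / ‖c‖ ^ i) ∧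
      ∀ y ∈ cylinder K n ‖c‖ ρ, ‖g y - MvPolynomial.eval y Q * f y
        - ∑ i ∈ Finset.range d, MvPolynomial.eval (Fin.tail y) (R i) * y 0 ^ i‖ ≤ C / 2 := by
  have hcp : 0 < ‖c‖ := norm_pos_iff.2 hc
  obtain ⟨P, hP⟩ := hg (C / 2) (by positivity)
  have hPC : ∀ y ∈ cylinder K n ‖c‖ ρ, ‖MvPolynomial.eval y P‖ ≤ C := by
    intro y hy
    have h1 := IsUltrametricDist.norm_add_le_max (g y) (-(g y - MvPolynomial.eval y P))
    rw [← sub_eq_add_neg, sub_sub_cancel, norm_neg] at h1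
    exact h1.trans (max_le (hgC y hy) ((hP y hy).trans (by linarith)))
  set p := MvPolynomial.finSuccEquiv K n P with hp
  have hcoef : ∀ x ∈ Metric.closedBall (0 : Fin n → K) ρ, ∀ i,
      ‖MvPolynomial.eval x (p.coeff i)‖ * ‖c‖ ^ i ≤ C := by
    intro x hx i
    have := norm_coeff_mul_pow_le (p.map (MvPolynomial.eval x)) c (C := C) (fun z hz => by
      rw [hp, ← MvPolynomial.eval_eq_eval_mv_eval']
      exact hPC _ ⟨by simpa using hz, by simpa using hx⟩) i
    simpa using this
  have heval : ∀ (q : Polynomial (MvPolynomial (Fin n) K)) (y : Fin (n + 1) → K),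
      MvPolynomial.eval y ((MvPolynomial.finSuccEquiv K n).symm q)
        = (q.map (MvPolynomial.eval (Fin.tail y))).eval (y 0) := by
    intro q y
    conv_lhs => rw [← Fin.cons_self_tail y]
    rw [MvPolynomial.eval_eq_eval_mv_eval', AlgEquiv.apply_symm_apply]
  set N := p.natDegree + 1 with hN
  set Q := (MvPolynomial.finSuccEquiv K n).symm
    (∑ i ∈ Finset.range N, Polynomial.C (p.coeff (d + i)) * Polynomial.X ^ i) with hQ
  have hQe : ∀ y, MvPolynomial.eval y Q = ∑ i ∈ Finset.range N,
      MvPolynomial.eval (Fin.tail y) (p.coeff (d + i)) * y 0 ^ i := by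
    intro y
    rw [hQ, heval, Polynomial.map_sum, Polynomial.eval_finsetSum]
    simp
  have hPe : ∀ y, MvPolynomial.eval y P = MvPolynomial.eval y Q * y 0 ^ d
      + ∑ i ∈ Finset.range d, MvPolynomial.eval (Fin.tail y) (p.coeff i) * y 0 ^ i := by
    intro y
    have h1 : MvPolynomial.eval y P = (p.map (MvPolynomial.eval (Fin.tail y))).eval (y 0) := by
      rw [← heval, hp, AlgEquiv.symm_apply_apply]
    have h2 : (p.map (MvPolynomial.eval (Fin.tail y))).natDegree < d + N :=
      (Polynomial.natDegree_map_le).trans_lt (by omega)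
    rw [h1, Polynomial.eval_eq_sum_range' h2, Finset.sum_range_add, hQe, Finset.sum_mul, add_comm]
    congr 1
    · refine Finset.sum_congr rfl fun i _ => ?_
      rw [Polynomial.coeff_map, pow_add]; ring
    · refine Finset.sum_congr rfl fun i _ => ?_
      rw [Polynomial.coeff_map]
  have hQb : ∀ y ∈ cylinder K n ‖c‖ ρ, ‖MvPolynomial.eval y Q‖ ≤ C / ‖c‖ ^ d := by
    intro y hy
    rw [hQe]
    refine IsUltrametricDist.norm_sum_le_of_forall_le_of_nonneg (by positivity) fun i _ => ?_
    rw [norm_mul, norm_pow, le_div_iff₀ (by positivity)]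
    have h1 := hcoef _ (mem_closedBall_zero_iff.2 hy.2) (d + i)
    refine le_trans ?_ h1
    rw [pow_add, mul_comm (‖c‖ ^ d), ← mul_assoc]
    gcongr
    exact hy.1
  refine ⟨Q, p.coeff, hQb, fun i x hx => ?_, fun y hy => ?_⟩
  · rw [le_div_iff₀ (by positivity)]
    exact hcoef x hx i
  · have e : g y - MvPolynomial.eval y Q * f y
        - ∑ i ∈ Finset.range d, MvPolynomial.eval (Fin.tail y) (p.coeff i) * y 0 ^ i
        = (g y - MvPolynomial.eval y P) + -(MvPolynomial.eval y Q * (f y - y 0 ^ d)) := by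
      rw [hPe]; ring
    rw [e]
    refine (IsUltrametricDist.norm_add_le_max _ _).trans (max_le (hP y hy) ?_)
    rw [norm_neg, norm_mul]
    refine (mul_le_mul (hQb y hy) (hfd y hy) (norm_nonneg _) (by positivity)).trans (le_of_eq ?_)
    field_simp

/-- Each approximate division halves the error, so quotients and remainders add up to geometrically
convergent series of polynomials. -/
theorem IsPolyLimitOn.exists_division_of_monic [CompleteSpace K] {c : K} (hc : c ≠ 0) {ρ : ℝ}
    {d : ℕ} {f : (Fin (n + 1) → K) → K} (hf : IsPolyLimitOn (cylinder K n ‖c‖ ρ) f)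
    (hfd : ∀ y ∈ cylinder K n ‖c‖ ρ, ‖f y - y 0 ^ d‖ ≤ 1 / 2 * ‖c‖ ^ d)
    {g : (Fin (n + 1) → K) → K} (hg : IsPolyLimitOn (cylinder K n ‖c‖ ρ) g) :
    ∃ (q : (Fin (n + 1) → K) → K) (r : ℕ → (Fin n → K) → K),
      IsPolyLimitOn (cylinder K n ‖c‖ ρ) q ∧
      (∀ i, IsPolyLimitOn (Metric.closedBall 0 ρ) (r i)) ∧
      ∀ y ∈ cylinder K n ‖c‖ ρ, g y = q y * f y
        + ∑ i ∈ Finset.range d, r i (Fin.tail y) * y 0 ^ i := by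
  set S := cylinder K n ‖c‖ ρ with hS
  have hcp : 0 < ‖c‖ := norm_pos_iff.2 hc
  have hSb : ∀ y ∈ S, ‖y‖ ≤ max ‖c‖ ρ := fun y hy => norm_le_of_mem_cylinder hy
  obtain ⟨C₀, hC₀, hgC₀⟩ := hg.exists_norm_le hSb
  set C := C₀ + 1 with hC
  have hCp : 0 < C := by positivity
  let Inv : ℕ → ((Fin (n + 1) → K) → K) → Prop := fun k h =>
    IsPolyLimitOn S h ∧ ∀ y ∈ S, ‖h y‖ ≤ C * (1 / 2) ^ k
  have step : ∀ k h, Inv k h → ∃ (Q : MvPolynomial (Fin (n + 1)) K)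
      (R : ℕ → MvPolynomial (Fin n) K),
      (∀ y ∈ S, ‖MvPolynomial.eval y Q‖ ≤ C / ‖c‖ ^ d * (1 / 2) ^ k) ∧
      (∀ i, ∀ x ∈ Metric.closedBall 0 ρ,
        ‖MvPolynomial.eval x (R i)‖ ≤ C / ‖c‖ ^ i * (1 / 2) ^ k) ∧
      Inv (k + 1) (fun y => h y - MvPolynomial.eval y Q * f y
        - ∑ i ∈ Finset.range d, MvPolynomial.eval (Fin.tail y) (R i) * y 0 ^ i) := by
    intro k h hh
    obtain ⟨Q, R, h1, h2, h3⟩ := exists_division_step hc hfd hh.1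
      (C := C * (1 / 2) ^ k) (by positivity) hh.2
    refine ⟨Q, R, fun y hy => (h1 y hy).trans (le_of_eq (by ring)),
      fun i x hx => (h2 i x hx).trans (le_of_eq (by ring)), ?_,
      fun y hy => (h3 y hy).trans (le_of_eq (by ring))⟩
    have hQf := (IsPolyLimitOn.eval (S := S) Q).mul hf hSb
    have hR := IsPolyLimitOn.eval (S := S) (∑ i ∈ Finset.range d,
      MvPolynomial.rename Fin.succ (R i) * MvPolynomial.X 0 ^ i)
    refine ((hh.1.add (hQf.const_mul (-1))).add (hR.const_mul (-1))).congr fun y _ => ?_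
    simp only [map_sum, map_mul, map_pow, MvPolynomial.eval_rename, MvPolynomial.eval_X,
      sub_eq_add_neg, neg_one_mul]
    rfl
  choose Q R hQ hR hInv using step
  let seq : (k : ℕ) → {h // Inv k h} := fun k => Nat.rec
    ⟨g, hg, fun y hy => by simpa using (hgC₀ y hy).trans (by linarith)⟩
    (fun k h => ⟨_, hInv k h.1 h.2⟩) k
  have hseq : ∀ k y, (seq (k + 1)).1 y = (seq k).1 y
      - MvPolynomial.eval y (Q k (seq k).1 (seq k).2) * f y
      - ∑ i ∈ Finset.range d,
        MvPolynomial.eval (Fin.tail y) (R k (seq k).1 (seq k).2 i) * y 0 ^ i := fun k y => rfl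
  obtain ⟨q, hq, hqt⟩ := exists_isPolyLimitOn_of_norm_le fun k => hQ k (seq k).1 (seq k).2
  have hr := fun i => exists_isPolyLimitOn_of_norm_le fun k => hR k (seq k).1 (seq k).2 i
  choose r hr hrt using hr
  refine ⟨q, r, hq, hr, fun y hy => ?_⟩
  have hyt : Fin.tail y ∈ Metric.closedBall 0 ρ := mem_closedBall_zero_iff.2 hy.2
  have hsum : ∀ N, g y = (seq N).1 y
      + ((∑ k ∈ Finset.range N, MvPolynomial.eval y (Q k (seq k).1 (seq k).2)) * f y
      + ∑ i ∈ Finset.range d, (∑ k ∈ Finset.range N,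
        MvPolynomial.eval (Fin.tail y) (R k (seq k).1 (seq k).2 i)) * y 0 ^ i) := by
    intro N
    induction N with
    | zero => simp [seq]
    | succ N ih =>
      rw [ih, hseq]
      simp_rw [Finset.sum_range_succ, add_mul, Finset.sum_add_distrib]
      ring
  have hz : Tendsto (fun N => (seq N).1 y) atTop (𝓝 0) := by
    refine squeeze_zero_norm (fun N => (seq N).2.2 y hy) ?_
    simpa using (tendsto_pow_atTop_nhds_zero_of_lt_one (r := (1 / 2 : ℝ)) (by norm_num)
      (by norm_num)).const_mul C
  have hlim := hz.add (((hqt y hy).mul_const (f y)).add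
    (tendsto_finsetSum (Finset.range d) fun i _ => (hrt i _ hyt).mul_const (y 0 ^ i)))
  simp_rw [← hsum] at hlim
  rw [zero_add] at hlim
  exact tendsto_nhds_unique tendsto_const_nhds hlim

/-- Weierstrass division on a cylinder. -/
theorem IsPolyLimitOn.exists_division [CompleteSpace K] {c a : K} (hc : c ≠ 0) (ha : a ≠ 0) {ρ : ℝ}
    {d : ℕ} {f : (Fin (n + 1) → K) → K} (hf : IsPolyLimitOn (cylinder K n ‖c‖ ρ) f)
    (hfd : ∀ y ∈ cylinder K n ‖c‖ ρ, ‖f y - a * y 0 ^ d‖ ≤ ‖a‖ * (1 / 2 * ‖c‖ ^ d))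
    {g : (Fin (n + 1) → K) → K} (hg : IsPolyLimitOn (cylinder K n ‖c‖ ρ) g) :
    ∃ (q : (Fin (n + 1) → K) → K) (r : ℕ → (Fin n → K) → K),
      IsPolyLimitOn (cylinder K n ‖c‖ ρ) q ∧
      (∀ i, IsPolyLimitOn (Metric.closedBall 0 ρ) (r i)) ∧
      ∀ y ∈ cylinder K n ‖c‖ ρ, g y = q y * f y
        + ∑ i ∈ Finset.range d, r i (Fin.tail y) * y 0 ^ i := by
  have hap : 0 < ‖a‖ := norm_pos_iff.2 ha
  have hb : ∀ y ∈ cylinder K n ‖c‖ ρ, ‖y‖ ≤ max ‖c‖ ρ := fun y hy => norm_le_of_mem_cylinder hy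
  have hconst := IsPolyLimitOn.eval (S := cylinder K n ‖c‖ ρ) (MvPolynomial.C a⁻¹)
  obtain ⟨q, r, hq, hr, h⟩ := (hconst.mul hf hb).exists_division_of_monic hc (d := d)
    (fun y hy => by
      have e : MvPolynomial.eval y (MvPolynomial.C a⁻¹) * f y - y 0 ^ d
          = a⁻¹ * (f y - a * y 0 ^ d) := by
        rw [MvPolynomial.eval_C]; field_simp
      rw [e, norm_mul, norm_inv, inv_mul_le_iff₀ hap]
      exact hfd y hy) hg
  refine ⟨fun y => q y * MvPolynomial.eval y (MvPolynomial.C a⁻¹), r, hq.mul hconst hb, hr,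
    fun y hy => ?_⟩
  rw [h y hy, mul_assoc]

end Division

/-! ### Weierstrass preparation -/

section Preparation
variable {K : Type*} [NontriviallyNormedField K] {n : ℕ}

theorem tail_single_zero (z : K) : Fin.tail (Pi.single 0 z : Fin (n + 1) → K) = 0 := by
  ext i
  simp [Fin.tail]

theorem norm_sub_single_zero (y : Fin (n + 1) → K) : ‖y - Pi.single 0 (y 0)‖ ≤ ‖Fin.tail y‖ := by
  refine (pi_norm_le_iff_of_nonneg (norm_nonneg _)).2 (Fin.cases ?_ fun i => ?_)
  · simp
  · simpa [Fin.tail] using norm_le_pi_norm (Fin.tail y) i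

theorem norm_single_zero_le (z : K) : ‖(Pi.single 0 z : Fin (n + 1) → K)‖ ≤ ‖z‖ := by
  refine (pi_norm_le_iff_of_nonneg (norm_nonneg _)).2 (Fin.cases ?_ fun i => ?_) <;> simp

variable [IsUltrametricDist K] [IsAlgClosed K] [CompleteSpace K] {f : (Fin (n + 1) → K) → K}

/-- A germ that does not vanish on the first axis is close to a monomial on small cylinders. -/
theorem IsAnalyticGerm.exists_cylinder (hf : IsAnalyticGerm f)
    (hreg : ∃ᶠ z in 𝓝 (0 : K), f (Pi.single 0 z) ≠ 0) :
    ∃ (d : ℕ) (a : K) (A : ℝ), a ≠ 0 ∧ 0 < A ∧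
      (∀ᶠ z in 𝓝 (0 : K), ‖f (Pi.single 0 z)‖ ≤ A * ‖z‖ ^ d) ∧
      ∀ η > 0, ∃ (c : K) (ρ : ℝ), c ≠ 0 ∧ ‖c‖ ≤ η ∧ 0 < ρ ∧ ρ ≤ η ∧
        IsPolyLimitOn (cylinder K n ‖c‖ ρ) f ∧
        ∀ y ∈ cylinder K n ‖c‖ ρ, ‖f y - a * y 0 ^ d‖ ≤ ‖a‖ * (1 / 2 * ‖c‖ ^ d) := by
  let l : (Fin 1 → K) →ₗ[K] (Fin (n + 1) → K) :=
    (LinearMap.single K (fun _ => K) 0).comp (LinearMap.proj 0)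
  have hl : ∀ s, l s = Pi.single 0 (s 0) := fun s => rfl
  obtain ⟨δ, hδ, hp⟩ := hf.comp_linear l
  obtain ⟨c₁, hc₁0, hc₁⟩ := NormedField.exists_norm_lt K hδ
  have hz : ∀ z : K, ‖(fun _ : Fin 1 => z)‖ = ‖z‖ := fun z => by simp
  rcases (hp.mono (Metric.closedBall_subset_closedBall hc₁.le)).eq_zero_or_exists_leadingTerm
    (norm_pos_iff.1 hc₁0) with h | ⟨d, a, C, ha, hC, h⟩
  · exfalso
    refine hreg ?_
    filter_upwards [Metric.closedBall_mem_nhds (0 : K) (ε := 1 / 2 * ‖c₁‖) (by positivity)]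
      with z hz'
    have := h (fun _ => z) (by rw [hz]; exact mem_closedBall_zero_iff.1 hz')
    rw [hl] at this
    exact not_not.2 this
  have hap : 0 < ‖a‖ := norm_pos_iff.2 ha
  have hlead : ∀ z : K, ‖z‖ ≤ ‖c₁‖ → ‖f (Pi.single 0 z) - a * z ^ d‖ ≤ C * ‖z‖ ^ (d + 1) := by
    intro z hz'
    have := h (fun _ => z) (by rwa [hz])
    rwa [hl, hz] at this
  refine ⟨d, a, C + ‖a‖, ha, by positivity, ?_, fun η hη => ?_⟩
  · filter_upwards [Metric.closedBall_mem_nhds (0 : K) (ε := min 1 ‖c₁‖) (by positivity)]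
      with z hz'
    have hz1 := mem_closedBall_zero_iff.1 hz'
    have h1 := hlead z (hz1.trans (min_le_right _ _))
    have h2 := norm_add_le (f (Pi.single 0 z) - a * z ^ d) (a * z ^ d)
    rw [sub_add_cancel, norm_mul, norm_pow] at h2
    have h3 : C * ‖z‖ ^ (d + 1) ≤ C * ‖z‖ ^ d :=
      mul_le_mul_of_nonneg_left (pow_le_pow_of_le_one (norm_nonneg _)
        (hz1.trans (min_le_left _ _)) (Nat.le_succ d)) hC
    rw [add_mul]
    linarith
  · obtain ⟨δ₀, hδ₀, hp₀⟩ := hf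
    obtain ⟨c, hc0, hc⟩ := NormedField.exists_norm_lt K
      (r := min (min δ₀ η) (min ‖c₁‖ (‖a‖ / (2 * (C + 1))))) (by positivity)
    have hcδ : ‖c‖ ≤ δ₀ := hc.le.trans ((min_le_left _ _).trans (min_le_left _ _))
    have hcη : ‖c‖ ≤ η := hc.le.trans ((min_le_left _ _).trans (min_le_right _ _))
    have hcc : ‖c‖ ≤ ‖c₁‖ := hc.le.trans ((min_le_right _ _).trans (min_le_left _ _))
    have hca : C * ‖c‖ ≤ ‖a‖ * (1 / 2) := by
      have := hc.le.trans ((min_le_right _ _).trans (min_le_right _ _))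
      rw [le_div_iff₀ (by positivity)] at this
      nlinarith
    -- This is the admissible error. The radius `ρ` is fixed after `c`: it is so small that an
    -- approximating polynomial with Lipschitz constant `L` moves by at most `ε` between a point and
    -- its projection to the axis.
    set ε := ‖a‖ * (1 / 2 * ‖c‖ ^ d) with hε
    have hεp : 0 < ε := by positivity
    obtain ⟨P, hP⟩ := hp₀ ε hεp
    obtain ⟨L, hL, hLip⟩ := exists_norm_eval_sub_le P δ₀
    have hρp : 0 < min (min δ₀ η) (ε / (L + 1)) := by positivity
    refine ⟨c, min (min δ₀ η) (ε / (L + 1)), norm_pos_iff.1 hc0, hcη, hρp,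
      (min_le_left _ _).trans (min_le_right _ _), hp₀.mono (cylinder_subset_closedBall hcδ
        ((min_le_left _ _).trans (min_le_left _ _))), fun y hy => ?_⟩
    have hyδ : ‖y‖ ≤ δ₀ := (norm_le_of_mem_cylinder hy).trans
      (max_le hcδ ((min_le_left _ _).trans (min_le_left _ _)))
    set s : Fin (n + 1) → K := Pi.single 0 (y 0) with hs
    have hsδ : ‖s‖ ≤ δ₀ := (norm_single_zero_le _).trans (hy.1.trans hcδ)
    have h1 := hP y (mem_closedBall_zero_iff.2 hyδ)
    have h2 := hP s (mem_closedBall_zero_iff.2 hsδ)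
    have h3 : ‖MvPolynomial.eval y P - MvPolynomial.eval s P‖ ≤ ε := by
      refine (hLip y s hyδ hsδ).trans ?_
      have h4 := (norm_sub_single_zero y).trans (hy.2.trans (min_le_right _ _))
      rw [le_div_iff₀ (by positivity)] at h4
      nlinarith [norm_nonneg (y - s)]
    have h4 : ‖f s - a * y 0 ^ d‖ ≤ ε := by
      refine (hlead (y 0) (hy.1.trans hcc)).trans ?_
      rw [pow_succ']
      calc C * (‖y 0‖ * ‖y 0‖ ^ d) ≤ C * (‖c‖ * ‖c‖ ^ d) := by gcongr <;> exact hy.1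
        _ = (C * ‖c‖) * ‖c‖ ^ d := by ring
        _ ≤ (‖a‖ * (1 / 2)) * ‖c‖ ^ d := by gcongr
        _ = ε := by rw [hε]; ring
    have e : f y - a * y 0 ^ d = (f y - MvPolynomial.eval y P)
        + ((MvPolynomial.eval y P - MvPolynomial.eval s P)
        + (-(f s - MvPolynomial.eval s P) + (f s - a * y 0 ^ d))) := by ring
    rw [e]
    refine (IsUltrametricDist.norm_add_le_max _ _).trans (max_le h1 ?_)
    refine (IsUltrametricDist.norm_add_le_max _ _).trans (max_le h3 ?_)
    refine (IsUltrametricDist.norm_add_le_max _ _).trans (max_le (by rwa [norm_neg]) h4)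

/-- Weierstrass preparation and division: near the origin the zero set of `f` is the zero set of a
distinguished polynomial in the first coordinate, and on it every analytic function is a polynomial
of smaller degree in the first coordinate. -/
theorem IsAnalyticGerm.exists_preparation (hf : IsAnalyticGerm f)
    (hreg : ∃ᶠ z in 𝓝 (0 : K), f (Pi.single 0 z) ≠ 0) :
    ∃ (d : ℕ) (a : ℕ → (Fin n → K) → K), (∀ i, IsAnalyticGerm (a i)) ∧ (∀ i < d, a i 0 = 0) ∧
      (∀ᶠ y in 𝓝 0, f y = 0 ↔ y 0 ^ d + ∑ i ∈ Finset.range d, a i (Fin.tail y) * y 0 ^ i = 0) ∧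
      ∀ g, IsAnalyticGerm g → ∃ r : ℕ → (Fin n → K) → K, (∀ i, IsAnalyticGerm (r i)) ∧
        ∀ᶠ y in 𝓝 0, f y = 0 → g y = ∑ i ∈ Finset.range d, r i (Fin.tail y) * y 0 ^ i := by
  obtain ⟨d, a, A, ha, hA, hfA, hcyl⟩ := hf.exists_cylinder hreg
  have hdiv : ∀ g, IsAnalyticGerm g → ∃ (q : (Fin (n + 1) → K) → K) (r : ℕ → (Fin n → K) → K),
      ContinuousAt q 0 ∧ (∀ i, IsAnalyticGerm (r i)) ∧
      ∀ᶠ y in 𝓝 0, g y = q y * f y + ∑ i ∈ Finset.range d, r i (Fin.tail y) * y 0 ^ i := by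
    rintro g ⟨η, hη, hg⟩
    obtain ⟨c, ρ, hc, hcη, hρ, hρη, hfp, hfd⟩ := hcyl η hη
    obtain ⟨q, r, hq, hr, h⟩ := hfp.exists_division hc ha hfd
      (hg.mono (cylinder_subset_closedBall hcη hρη))
    have hm : cylinder K n ‖c‖ ρ ∈ 𝓝 0 := cylinder_mem_nhds (norm_pos_iff.2 hc) hρ
    exact ⟨q, r, hq.continuousOn.continuousAt hm, fun i => ⟨ρ, hρ, hr i⟩,
      Filter.mem_of_superset hm h⟩
  -- Dividing `y 0 ^ d` by `f` yields the distinguished polynomial as `y 0 ^ d` minus the remainder,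
  -- which equals `q * f`.
  obtain ⟨q, r, hq, hr, h⟩ := hdiv (fun y => y 0 ^ d) ((IsAnalyticGerm.coord 0).pow d)
  have hsing : Tendsto (fun z : K => (Pi.single 0 z : Fin (n + 1) → K)) (𝓝 0) (𝓝 0) :=
    (continuous_single (A := fun _ => K) 0).tendsto' 0 0 (by simp)
  have hz : ∀ᶠ z in 𝓝 (0 : K), z ^ d = q (Pi.single 0 z) * f (Pi.single 0 z)
      + ∑ i ∈ Finset.range d, r i 0 * z ^ i := by
    filter_upwards [hsing.eventually h] with z hz
    simpa [tail_single_zero] using hz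
  have hqs : Tendsto (fun z => q (Pi.single 0 z)) (𝓝 0) (𝓝 (q 0)) :=
    Tendsto.comp hq hsing
  have hqB : ∀ᶠ z in 𝓝 (0 : K), ‖q (Pi.single 0 z)‖ < ‖q 0‖ + 1 :=
    hqs.norm.eventually (gt_mem_nhds (lt_add_one _))
  -- On the axis both `z ^ d` and `q * f` are O(‖z‖ ^ d), hence so is the remainder. It has degree
  -- less than `d` in `z`, so the Gauss bound on shrinking balls kills its coefficients.
  have hr0 : ∀ i < d, r i 0 = 0 := by
    intro i hi
    set D := 1 + (‖q 0‖ + 1) * A with hD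
    have hD0 : 0 < D := by positivity
    obtain ⟨ε, hε, hall⟩ := Metric.nhds_basis_closedBall.eventually_iff.1 (hz.and (hqB.and hfA))
    by_contra hne
    have hnp : 0 < ‖r i 0‖ := norm_pos_iff.2 hne
    obtain ⟨c, hc0, hc⟩ := NormedField.exists_norm_lt K
      (r := min (min 1 ε) (‖r i 0‖ / D)) (by positivity)
    have hc1 : ‖c‖ ≤ 1 := hc.le.trans ((min_le_left _ _).trans (min_le_left _ _))
    have hcε : ‖c‖ ≤ ε := hc.le.trans ((min_le_left _ _).trans (min_le_right _ _))
    have hcD := hc.trans_le (min_le_right _ _)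
    rw [lt_div_iff₀ hD0] at hcD
    have h1 := norm_coeff_mul_pow_le
      (∑ j ∈ Finset.range d, Polynomial.C (r j 0) * Polynomial.X ^ j) c (C := D * ‖c‖ ^ d)
      (fun z hzc => by
        obtain ⟨h2, h3, h4⟩ := hall (mem_closedBall_zero_iff.2 (hzc.trans hcε))
        rw [Polynomial.eval_finsetSum]
        simp only [Polynomial.eval_mul, Polynomial.eval_C, Polynomial.eval_pow, Polynomial.eval_X]
        rw [← sub_eq_iff_eq_add'.2 h2]
        refine (norm_sub_le _ _).trans ?_
        rw [norm_pow, norm_mul]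
        have h5 := mul_le_mul h3.le h4 (norm_nonneg _) (by positivity)
        have h6 : ‖z‖ ^ d ≤ ‖c‖ ^ d := by gcongr
        calc _ ≤ ‖z‖ ^ d + (‖q 0‖ + 1) * (A * ‖z‖ ^ d) := by linarith
          _ = D * ‖z‖ ^ d := by rw [hD]; ring
          _ ≤ _ := by gcongr) i
    have hco : (∑ j ∈ Finset.range d, Polynomial.C (r j 0) * Polynomial.X ^ j).coeff i = r i 0 := by
      simp [Polynomial.coeff_C_mul, Polynomial.coeff_X_pow, hi]
    rw [hco] at h1
    obtain ⟨k, rfl⟩ := Nat.exists_eq_add_of_lt hi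
    have h2 : ‖c‖ ^ (i + k + 1) = ‖c‖ ^ k * ‖c‖ * ‖c‖ ^ i := by ring
    rw [h2, ← mul_assoc] at h1
    have h3 := le_of_mul_le_mul_right h1 (by positivity)
    have h4 : ‖c‖ ^ k ≤ 1 := pow_le_one₀ (norm_nonneg _) hc1
    have h5 : D * (‖c‖ ^ k * ‖c‖) ≤ D * ‖c‖ :=
      mul_le_mul_of_nonneg_left (mul_le_of_le_one_left (norm_nonneg _) h4) hD0.le
    linarith
  -- The axis now satisfies `z ^ d = q * f` with ‖f‖ ≤ A‖z‖ ^ d, so ‖q‖ ≥ 1/A there. Thus `q` is a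
  -- unit at the origin and does not alter the zero set.
  have hq0 : q 0 ≠ 0 := by
    have h1 : ∀ᶠ z in 𝓝[≠] (0 : K), 1 ≤ ‖q (Pi.single 0 z)‖ * A := by
      filter_upwards [nhdsWithin_le_nhds hz, nhdsWithin_le_nhds hfA, self_mem_nhdsWithin]
        with z h2 h3 h4
      have h5 : 0 < ‖z‖ ^ d := pow_pos (norm_pos_iff.2 h4) d
      rw [Finset.sum_eq_zero fun i hi => by rw [hr0 i (Finset.mem_range.1 hi), zero_mul],
        add_zero] at h2
      have h6 := congrArg norm h2
      rw [norm_pow, norm_mul] at h6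
      refine le_of_mul_le_mul_right ?_ h5
      rw [one_mul, mul_assoc]
      exact h6.le.trans (mul_le_mul_of_nonneg_left h3 (norm_nonneg _))
    have h2 := ge_of_tendsto ((hqs.norm.mul_const A).mono_left nhdsWithin_le_nhds) h1
    intro h3
    rw [h3, norm_zero, zero_mul] at h2
    linarith
  refine ⟨d, fun i x => - r i x, fun i => (hr i).neg, fun i hi => by simp [hr0 i hi], ?_,
    fun g hg => ?_⟩
  · filter_upwards [h, hq.eventually_ne hq0] with y hy hqy
    have : y 0 ^ d + ∑ i ∈ Finset.range d, -r i (Fin.tail y) * y 0 ^ i = q y * f y := by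
      rw [hy]
      simp_rw [neg_mul, Finset.sum_neg_distrib]
      ring
    rw [this, mul_eq_zero, or_iff_right hqy]
  · obtain ⟨q', r', _, hr', h'⟩ := hdiv g hg
    refine ⟨r', hr', ?_⟩
    filter_upwards [h'] with y hy hfy
    rw [hy, hfy, mul_zero, zero_add]

end Preparation

/-! ### Common roots by resultants of a pencil -/

section Resultant
variable {K : Type*} [Field K]

/-- The polynomial with coefficients `b i` for `i < d`. -/
noncomputable def polyOfCoeffs (d : ℕ) (b : ℕ → K) : Polynomial K :=
  ∑ i ∈ Finset.range d, Polynomial.C (b i) * Polynomial.X ^ i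

theorem coeff_polyOfCoeffs (d : ℕ) (b : ℕ → K) (k : ℕ) :
    (polyOfCoeffs d b).coeff k = if k < d then b k else 0 := by
  simp [polyOfCoeffs, Polynomial.finsetSum_coeff, Polynomial.coeff_C_mul, Polynomial.coeff_X_pow]

theorem eval_polyOfCoeffs (d : ℕ) (b : ℕ → K) (z : K) :
    (polyOfCoeffs d b).eval z = ∑ i ∈ Finset.range d, b i * z ^ i := by
  simp [polyOfCoeffs, Polynomial.eval_finsetSum]

theorem degree_polyOfCoeffs_lt (d : ℕ) (b : ℕ → K) : (polyOfCoeffs d b).degree < d := by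
  rw [Polynomial.degree_lt_iff_coeff_zero]
  intro m hm
  rw [coeff_polyOfCoeffs, if_neg (by omega)]

theorem monic_X_pow_add_polyOfCoeffs (d : ℕ) (a : ℕ → K) :
    (Polynomial.X ^ d + polyOfCoeffs d a).Monic :=
  Polynomial.monic_X_pow_add (degree_polyOfCoeffs_lt d a)

theorem natDegree_X_pow_add_polyOfCoeffs (d : ℕ) (a : ℕ → K) :
    (Polynomial.X ^ d + polyOfCoeffs d a).natDegree = d := by
  refine Polynomial.natDegree_eq_of_degree_eq_some ?_
  rw [Polynomial.degree_add_eq_left_of_degree_lt] <;> rw [Polynomial.degree_X_pow]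
  exact degree_polyOfCoeffs_lt d a

/-- If sufficiently many members of a pencil of polynomials have a common root with a given monic
polynomial, then all polynomials that span the pencil share a root with it. -/
theorem exists_common_root (d s : ℕ) (a : ℕ → K) (b : Fin s → ℕ → K) {t : ℕ → K}
    (ht : Function.Injective t)
    (h : ∀ k < d * s + 1, ∃ ζ, (Polynomial.X ^ d + polyOfCoeffs d a).eval ζ = 0 ∧
      (polyOfCoeffs d fun i => ∑ j : Fin s, t k ^ (j : ℕ) * b j i).eval ζ = 0) :
    ∃ ζ, (Polynomial.X ^ d + polyOfCoeffs d a).eval ζ = 0 ∧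
      ∀ j, (polyOfCoeffs d (b j)).eval ζ = 0 := by
  classical
  have hne := (monic_X_pow_add_polyOfCoeffs d a).ne_zero
  have h' : ∀ k, ∃ ζ, k < d * s + 1 → (Polynomial.X ^ d + polyOfCoeffs d a).eval ζ = 0 ∧
      (polyOfCoeffs d fun i => ∑ j : Fin s, t k ^ (j : ℕ) * b j i).eval ζ = 0 := by
    intro k
    by_cases hk : k < d * s + 1
    · obtain ⟨ζ, hζ⟩ := h k hk
      exact ⟨ζ, fun _ => hζ⟩
    · exact ⟨0, fun h => absurd h hk⟩
  choose ζ hζ using h'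
  have hcard : (Polynomial.X ^ d + polyOfCoeffs d a).roots.toFinset.card ≤ d := by
    refine (Multiset.toFinset_card_le _).trans ?_
    have := Polynomial.card_roots' (Polynomial.X ^ d + polyOfCoeffs d a)
    rwa [natDegree_X_pow_add_polyOfCoeffs] at this
  -- The `d * s + 1` parameters select among at most `d` roots, so more than `s` of them select the
  -- same `ξ`. The pencil at `ξ` is a polynomial of degree less than `s` in the parameter and
  -- therefore vanishes identically.
  obtain ⟨ξ, hξ, hlt⟩ := Finset.exists_lt_card_fiber_of_mul_lt_card_of_maps_to (n := s)
    (s := Finset.range (d * s + 1)) (t := (Polynomial.X ^ d + polyOfCoeffs d a).roots.toFinset)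
    (f := ζ) (fun k hk => by
      rw [Multiset.mem_toFinset, Polynomial.mem_roots hne]
      exact (hζ k (Finset.mem_range.1 hk)).1) (by
      rw [Finset.card_range]
      exact Nat.lt_succ_of_le (Nat.mul_le_mul_right s hcard))
  rw [Multiset.mem_toFinset, Polynomial.mem_roots hne] at hξ
  refine ⟨ξ, hξ, ?_⟩
  have hz : (∑ j : Fin s, Polynomial.C ((polyOfCoeffs d (b j)).eval ξ) * Polynomial.X ^ (j : ℕ))
      = 0 := by
    refine Polynomial.eq_zero_of_degree_lt_of_eval_index_eq_zero _ (v := t) ht.injOn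
      ((Polynomial.degree_sum_fin_lt _).trans (by exact_mod_cast hlt)) fun k hk => ?_
    obtain ⟨hk1, rfl⟩ := Finset.mem_filter.1 hk
    have h2 := (hζ k (Finset.mem_range.1 hk1)).2
    simp only [eval_polyOfCoeffs, Finset.sum_mul] at h2
    rw [Finset.sum_comm] at h2
    rw [Polynomial.eval_finsetSum, ← h2]
    refine Finset.sum_congr rfl fun j _ => ?_
    simp only [eval_polyOfCoeffs, Polynomial.eval_mul, Polynomial.eval_C, Polynomial.eval_pow,
      Polynomial.eval_X, Finset.sum_mul]
    exact Finset.sum_congr rfl fun i _ => by ring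
  intro j
  have := congrArg (Polynomial.coeff · (j : ℕ)) hz
  simpa [Polynomial.finsetSum_coeff, Polynomial.coeff_C_mul, Polynomial.coeff_X_pow, Fin.val_inj]
    using this

/-- The resultant with a monic polynomial is the product of values at its roots. Using the formal
degree `d` for the second polynomial keeps the Sylvester matrix of constant size when the
coefficients vary, at the cost of a power of the leading coefficient 1. -/
theorem resultant_polyOfCoeffs_eq_zero_iff [IsAlgClosed K] (d : ℕ) (a b : ℕ → K) :
    Polynomial.resultant (Polynomial.X ^ d + polyOfCoeffs d a) (polyOfCoeffs d b) d d = 0 ↔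
      ∃ ζ, (Polynomial.X ^ d + polyOfCoeffs d a).eval ζ = 0 ∧ (polyOfCoeffs d b).eval ζ = 0 := by
  have h := Polynomial.resultant_eq_prod_eval (Polynomial.X ^ d + polyOfCoeffs d a)
    (polyOfCoeffs d b) d (Polynomial.natDegree_le_iff_degree_le.2 (degree_polyOfCoeffs_lt d b).le)
    (IsAlgClosed.splits _)
  rw [natDegree_X_pow_add_polyOfCoeffs, (monic_X_pow_add_polyOfCoeffs d a).leadingCoeff, one_pow,
    one_mul] at h
  rw [h, Multiset.prod_eq_zero_iff, Multiset.mem_map]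
  refine exists_congr fun ζ => and_congr_left fun _ => ?_
  rw [Polynomial.mem_roots (monic_X_pow_add_polyOfCoeffs d a).ne_zero, Polynomial.IsRoot]

end Resultant

/-! ### Elimination of one variable -/

section Projection
variable {K : Type*} [NontriviallyNormedField K] {n : ℕ}

/-- Near the origin `W` is the common zero set of finitely many analytic functions. -/
def IsZeroLocusGerm (W : Set (Fin n → K)) : Prop :=
  ∃ (s : ℕ) (F : Fin s → (Fin n → K) → K), (∀ j, IsAnalyticGerm (F j)) ∧
    ∀ᶠ w in 𝓝 0, w ∈ W ↔ ∀ j, F j w = 0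

theorem IsZeroLocusGerm.preimage {W : Set (Fin n → K)} (hW : IsZeroLocusGerm W) {m : ℕ}
    (l : (Fin m → K) →ₗ[K] (Fin n → K)) : IsZeroLocusGerm (l ⁻¹' W) := by
  obtain ⟨s, F, hF, h⟩ := hW
  exact ⟨s, fun j x => F j (l x), fun j => (hF j).comp_linear l,
    (l.continuous_on_pi.tendsto' 0 0 (map_zero l)).eventually h⟩

theorem IsZeroLocusGerm.inter {W W' : Set (Fin n → K)} (hW : IsZeroLocusGerm W)
    (hW' : IsZeroLocusGerm W') : IsZeroLocusGerm (W ∩ W') := by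
  obtain ⟨s, F, hF, h⟩ := hW
  obtain ⟨s', F', hF', h'⟩ := hW'
  refine ⟨s + s', Fin.append F F', fun j => ?_, ?_⟩
  · refine Fin.addCases (fun i => ?_) (fun i => ?_) j
    · simpa using hF i
    · simpa using hF' i
  · filter_upwards [h, h'] with w hw hw'
    rw [Set.mem_inter_iff, hw, hw', Fin.forall_fin_add]
    simp

variable [IsUltrametricDist K]

/-- If ‖ζ‖ > η, every lower term is at most η‖ζ‖ ^ (d - 1), which is less than ‖ζ‖ ^ d, so the terms
cannot cancel. This keeps points lifted along the projection close to the origin. -/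
theorem norm_root_le {d : ℕ} {a : ℕ → K} {η : ℝ} (hη : 0 < η) (hη1 : η ≤ 1)
    (ha : ∀ i < d, ‖a i‖ ≤ η ^ d) {ζ : K}
    (hζ : (Polynomial.X ^ d + polyOfCoeffs d a).eval ζ = 0) : ‖ζ‖ ≤ η := by
  by_contra hlt
  push Not at hlt
  have hζp : 0 < ‖ζ‖ := hη.trans hlt
  rw [Polynomial.eval_add, Polynomial.eval_pow, Polynomial.eval_X, eval_polyOfCoeffs,
    add_eq_zero_iff_eq_neg] at hζ
  have h1 := congrArg norm hζ
  rw [norm_neg, norm_pow] at h1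
  rcases Nat.eq_zero_or_pos d with rfl | hd
  · simp at h1
  have h2 : ‖∑ i ∈ Finset.range d, a i * ζ ^ i‖ ≤ η * ‖ζ‖ ^ (d - 1) := by
    refine IsUltrametricDist.norm_sum_le_of_forall_le_of_nonneg (by positivity) fun i hi => ?_
    have hi := Finset.mem_range.1 hi
    rw [norm_mul, norm_pow]
    have h3 : ‖a i‖ ≤ η * η ^ (d - 1 - i) := by
      rw [← pow_succ']
      exact (ha i hi).trans (pow_le_pow_of_le_one hη.le hη1 (by omega))
    have h4 : η ^ (d - 1 - i) ≤ ‖ζ‖ ^ (d - 1 - i) := pow_le_pow_left₀ hη.le hlt.le _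
    calc ‖a i‖ * ‖ζ‖ ^ i ≤ (η * ‖ζ‖ ^ (d - 1 - i)) * ‖ζ‖ ^ i := by
          gcongr
          exact h3.trans (by gcongr)
      _ = η * ‖ζ‖ ^ (d - 1) := by
          rw [mul_assoc, ← pow_add]; congr 2; omega
  rw [← h1] at h2
  obtain ⟨e, rfl⟩ : ∃ e, d = e + 1 := ⟨d - 1, by omega⟩
  rw [pow_succ', Nat.add_sub_cancel] at h2
  exact absurd (le_of_mul_le_mul_right h2 (by positivity)) (not_le.2 hlt)

variable [IsAlgClosed K] [CompleteSpace K]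

/-- The projection of a zero locus along an axis that is not contained in it near the origin is
finite, and its image is again a zero locus. -/
theorem IsZeroLocusGerm.exists_projection {W : Set (Fin (n + 1) → K)} (hW : IsZeroLocusGerm W)
    (hreg : ∃ᶠ z in 𝓝 (0 : K), (Pi.single 0 z : Fin (n + 1) → K) ∉ W) :
    ∃ W' : Set (Fin n → K), IsZeroLocusGerm W' ∧
      (∀ U ∈ 𝓝 (0 : Fin (n + 1) → K), ∀ᶠ x in 𝓝 0, x ∈ W' → ∃ w ∈ W ∩ U, Fin.tail w = x) ∧
      (∀ᶠ w in 𝓝 0, w ∈ W → Fin.tail w ∈ W') ∧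
      (∀ᶠ w in 𝓝 0, w ∈ W → Fin.tail w = 0 → w = 0) ∧
      ∃ d : ℕ, ∀ g, IsAnalyticGerm g → ∃ r : ℕ → (Fin n → K) → K, (∀ i, IsAnalyticGerm (r i)) ∧
        ∀ᶠ w in 𝓝 0, w ∈ W → g w = ∑ i ∈ Finset.range d, r i (Fin.tail w) * w 0 ^ i := by
  obtain ⟨s, F, hF, hWF⟩ := hW
  have hsing : Tendsto (fun z : K => (Pi.single 0 z : Fin (n + 1) → K)) (𝓝 0) (𝓝 0) :=
    (continuous_single (A := fun _ => K) 0).tendsto' 0 0 (by simp)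
  obtain ⟨j₀, hj₀⟩ : ∃ j, ∃ᶠ z in 𝓝 (0 : K), F j (Pi.single 0 z) ≠ 0 := by
    rw [← frequently_exists]
    refine (hreg.and_eventually (hsing.eventually hWF)).mono fun z hz => ?_
    rw [hz.2] at hz
    push Not at hz
    exact hz.1
  obtain ⟨d, a, ha, ha0, hP, hdiv⟩ := (hF j₀).exists_preparation hj₀
  choose r hr hFr using fun j => hdiv (F j) (hF j)
  have hPe : ∀ y : Fin (n + 1) → K, y 0 ^ d + ∑ i ∈ Finset.range d, a i (Fin.tail y) * y 0 ^ i
      = (Polynomial.X ^ d + polyOfCoeffs d fun i => a i (Fin.tail y)).eval (y 0) := fun y => by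
    simp [eval_polyOfCoeffs]
  let t := Infinite.natEmbedding K
  -- On the zero set of `F j₀` each `F j` is its remainder `r j`. A point thus lifts exactly when
  -- the distinguished polynomial and all remainders share a root, which these resultants detect.
  let F' : Fin (d * s + 1) → (Fin n → K) → K := fun k x =>
    Polynomial.resultant (Polynomial.X ^ d + polyOfCoeffs d fun i => a i x)
      (polyOfCoeffs d fun i => ∑ j : Fin s, t k ^ (j : ℕ) * r j i x) d d
  have hF' : ∀ k, IsAnalyticGerm (F' k) := by
    intro k
    refine IsAnalyticGerm.det fun i j => ?_
    have h1 : ∀ m, IsAnalyticGerm fun x =>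
        (Polynomial.X ^ d + polyOfCoeffs d fun i => a i x).coeff m := by
      intro m
      simp only [Polynomial.coeff_add, coeff_polyOfCoeffs]
      split_ifs
      · exact (IsAnalyticGerm.const _).add (ha m)
      · exact (IsAnalyticGerm.const _).add (.const _)
    have h2 : ∀ m, IsAnalyticGerm fun x =>
        (polyOfCoeffs d fun i => ∑ j : Fin s, t k ^ (j : ℕ) * r j i x).coeff m := by
      intro m
      simp only [coeff_polyOfCoeffs]
      split_ifs
      · exact .sum _ fun j _ => (IsAnalyticGerm.const _).mul (hr j m)
      · exact .const _
    refine Fin.addCases (fun j => ?_) (fun j => ?_) j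
    · simp only [Polynomial.sylvester, Matrix.of_apply, Fin.addCases_left]
      split_ifs
      · exact h2 _
      · exact .const _
    · simp only [Polynomial.sylvester, Matrix.of_apply, Fin.addCases_right]
      split_ifs
      · exact h1 _
      · exact .const _
  have hev := hWF.and (hP.and (eventually_all.2 hFr))
  refine ⟨{x | ∀ k, F' k x = 0}, ⟨_, F', hF', Eventually.of_forall fun x => Iff.rfl⟩,
    fun U hU => ?_, ?_, ?_, d, fun g hg => ?_⟩
  · obtain ⟨ε, hε, hball⟩ := Metric.nhds_basis_closedBall.eventually_iff.1
      (hev.and (eventually_mem_set.2 hU))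
    set η := min 1 ε with hη
    have hηp : 0 < η := by positivity
    have hsmall : ∀ᶠ x in 𝓝 (0 : Fin n → K), ∀ i : Fin d, ‖a i x‖ ≤ η ^ d := by
      refine eventually_all.2 fun i => ?_
      have := (ha i).continuousAt.norm
      rw [ContinuousAt, ha0 i i.2, norm_zero] at this
      exact (this.eventually (gt_mem_nhds (pow_pos hηp d))).mono fun x hx => hx.le
    filter_upwards [hsmall, Metric.closedBall_mem_nhds (0 : Fin n → K) hηp] with x hx hxη hxW
    obtain ⟨ζ, hζ, hζr⟩ := exists_common_root d s (fun i => a i x) (fun j i => r j i x)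
      t.injective fun k hk => (resultant_polyOfCoeffs_eq_zero_iff d _ _).1 (hxW ⟨k, hk⟩)
    have hζη : ‖ζ‖ ≤ η := norm_root_le hηp (min_le_left _ _) (fun i hi => hx ⟨i, hi⟩) hζ
    have hw : ‖(Fin.cons ζ x : Fin (n + 1) → K)‖ ≤ ε := by
      refine (norm_le_of_mem_cylinder (δ := η) (ρ := η) ⟨by simpa using hζη, ?_⟩).trans ?_
      · rw [Fin.tail_cons]; exact mem_closedBall_zero_iff.1 hxη
      · rw [max_self]; exact min_le_right _ _
    obtain ⟨⟨h1, h2, h3⟩, h4⟩ := hball (mem_closedBall_zero_iff.2 hw)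
    have h5 : F j₀ (Fin.cons ζ x) = 0 := by
      rw [h2, hPe, Fin.tail_cons, Fin.cons_zero]
      exact hζ
    refine ⟨Fin.cons ζ x, ⟨h1.2 fun j => ?_, h4⟩, Fin.tail_cons _ _⟩
    rw [h3 j h5, Fin.tail_cons, Fin.cons_zero, ← eval_polyOfCoeffs]
    exact hζr j
  · filter_upwards [hev] with w ⟨h1, h2, h3⟩ hw k
    have hw := h1.1 hw
    refine (resultant_polyOfCoeffs_eq_zero_iff d _ _).2 ⟨w 0, ?_, ?_⟩
    · rw [← hPe, ← h2]; exact hw j₀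
    · simp only [eval_polyOfCoeffs, Finset.sum_mul]
      rw [Finset.sum_comm]
      refine Finset.sum_eq_zero fun j _ => ?_
      simp_rw [mul_assoc, ← Finset.mul_sum]
      rw [← h3 j (hw j₀), hw j, mul_zero]
  -- Over 0 the distinguished polynomial is the pure power `w 0 ^ d`, so the fibre is the origin.
  · filter_upwards [hev] with w ⟨h1, h2, _⟩ hw hwt
    have hw := h2.1 (h1.1 hw j₀)
    rw [hwt, Finset.sum_eq_zero fun i hi => by rw [ha0 i (Finset.mem_range.1 hi), zero_mul],
      add_zero] at hw
    have hw0 := eq_zero_of_pow_eq_zero hw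
    rw [← Fin.cons_self_tail w, hwt, hw0]
    exact funext (Fin.cases rfl fun _ => rfl)
  · obtain ⟨q, hq, h⟩ := hdiv g hg
    refine ⟨q, hq, ?_⟩
    filter_upwards [hWF, h] with w h1 h2 hw
    exact h2 (h1.1 hw j₀)

end Projection

/-! ### Noether normalization and finite generation -/

section LinearProjections
variable {K : Type*} [NontriviallyNormedField K] {n : ℕ}

theorem exists_linearEquiv_single_eq {v : Fin (n + 1) → K} (hv : v ≠ 0) :
    ∃ φ : (Fin (n + 1) → K) ≃ₗ[K] (Fin (n + 1) → K), ∀ z, φ (Pi.single 0 z) = z • v := by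
  have : SeparatingDual K (Fin (n + 1) → K) := ⟨fun x hx => by
    obtain ⟨i, hi⟩ := Function.ne_iff.1 hx
    exact ⟨ContinuousLinearMap.proj i, hi⟩⟩
  obtain ⟨A, hA⟩ := SeparatingDual.exists_continuousLinearEquiv_apply_eq (R := K)
    (x := (Pi.single 0 1 : Fin (n + 1) → K)) (y := v) (by simp) hv
  refine ⟨A.toLinearEquiv, fun z => ?_⟩
  have : (Pi.single 0 z : Fin (n + 1) → K) = z • Pi.single 0 1 := by
    rw [← Pi.single_smul, smul_eq_mul, mul_one]
  rw [this, map_smul]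
  exact congrArg (z • ·) hA

/-- The linear projection that forgets the first coordinate. -/
def tailLinear (K : Type*) [NontriviallyNormedField K] (n : ℕ) :
    (Fin (n + 1) → K) →ₗ[K] (Fin n → K) :=
  LinearMap.funLeft K K Fin.succ

theorem tailLinear_apply (w : Fin (n + 1) → K) : tailLinear K n w = Fin.tail w := rfl

theorem tail_tendsto : Tendsto (Fin.tail : (Fin (n + 1) → K) → Fin n → K) (𝓝 0) (𝓝 0) :=
  tail_continuous.tendsto' 0 0 rfl

/-- A linear map that vanishes on the first axis factors through the other coordinates. -/
theorem exists_comp_tail {e : ℕ} (y : (Fin (n + 1) → K) →ₗ[K] (Fin e → K))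
    (hy : ∀ z, y (Pi.single 0 z) = 0) :
    ∃ y' : (Fin n → K) →ₗ[K] (Fin e → K), ∀ w, y w = y' (Fin.tail w) := by
  let s : (Fin n → K) →ₗ[K] (Fin (n + 1) → K) :=
    LinearMap.pi (Fin.cons 0 fun i => LinearMap.proj i)
  refine ⟨y.comp s, fun w => ?_⟩
  have h : w = Pi.single 0 (w 0) + s (Fin.tail w) := by
    ext i
    refine Fin.cases ?_ (fun j => ?_) i
    · simp [s]
    · simp [s, Fin.tail]
  conv_lhs => rw [h, map_add, hy, zero_add]
  rfl

variable [IsUltrametricDist K] [IsAlgClosed K] [CompleteSpace K]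

/-- A germ that does not vanish near the origin does not vanish on some line. -/
theorem IsAnalyticGerm.exists_line {f : (Fin n → K) → K} (hf : IsAnalyticGerm f)
    (h : ∃ᶠ w in 𝓝 0, f w ≠ 0) :
    ∃ v, f v ≠ 0 ∧ ∃ᶠ z in 𝓝 (0 : K), f (z • v) ≠ 0 := by
  obtain ⟨δ, hδ, hp⟩ := hf
  -- With ‖c‖ > 2 the parameter 1 lies in the ball of radius ‖c‖/2, on which the dichotomy asserts
  -- vanishing; `v` is so short that the disc of radius ‖c‖ times `v` stays in the domain. Vanishing
  -- along the line would contradict `hfv`.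
  obtain ⟨c, hc⟩ := NormedField.exists_lt_norm K 2
  have hcp : 0 < ‖c‖ := by linarith
  obtain ⟨v, hfv, hv⟩ := (h.and_eventually
    (Metric.closedBall_mem_nhds (0 : Fin n → K) (div_pos hδ hcp))).exists
  have hv := mem_closedBall_zero_iff.1 hv
  rw [le_div_iff₀ hcp] at hv
  refine ⟨v, hfv, ?_⟩
  let l : (Fin 1 → K) →ₗ[K] (Fin n → K) := (LinearMap.proj 0).smulRight v
  have hl : ∀ s, l s = s 0 • v := fun s => rfl
  have hz : ∀ z : K, ‖(fun _ : Fin 1 => z)‖ = ‖z‖ := fun z => by simp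
  have hφ : IsPolyLimitOn (Metric.closedBall 0 ‖c‖) fun s => f (l s) := by
    refine (hp.comp_linear l).mono fun s hs => ?_
    rw [Set.mem_preimage, mem_closedBall_zero_iff, hl, norm_smul]
    have := (norm_le_pi_norm s 0).trans (mem_closedBall_zero_iff.1 hs)
    nlinarith [norm_nonneg v]
  rcases hφ.eq_zero_or_exists_leadingTerm (norm_pos_iff.1 hcp) with h0 | ⟨d, a, C, ha, hC, h1⟩
  · exfalso
    have := h0 (fun _ => 1) (by rw [hz, norm_one]; linarith)
    rw [hl, one_smul] at this
    exact hfv this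
  · have hap : 0 < ‖a‖ := norm_pos_iff.2 ha
    have : ∀ᶠ z in 𝓝[≠] (0 : K), f (z • v) ≠ 0 := by
      filter_upwards [self_mem_nhdsWithin, nhdsWithin_le_nhds (Metric.ball_mem_nhds (0 : K)
        (ε := min ‖c‖ (‖a‖ / (C + 1))) (by positivity))] with z hz0 hzb h2
      have hzb := mem_ball_zero_iff.1 hzb
      have h3 := h1 (fun _ => z) (by rw [hz]; exact hzb.le.trans (min_le_left _ _))
      rw [hl, hz, h2, zero_sub, norm_neg, norm_mul, norm_pow, pow_succ', ← mul_assoc] at h3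
      have h4 := le_of_mul_le_mul_right h3 (pow_pos (norm_pos_iff.2 hz0) d)
      have h5 := hzb.trans_le (min_le_right _ _)
      rw [lt_div_iff₀ (by positivity)] at h5
      nlinarith [norm_nonneg z]
    exact this.frequently.filter_mono nhdsWithin_le_nhds

/-- Noether normalization: some linear projection of a zero locus is finite and open at the
origin. -/
theorem IsZeroLocusGerm.exists_finite_open_projection {W : Set (Fin n → K)}
    (hW : IsZeroLocusGerm W) (h0 : 0 ∈ W) :
    ∃ (e : ℕ) (y : (Fin n → K) →ₗ[K] (Fin e → K)), (∀ᶠ w in 𝓝 0, w ∈ W → y w = 0 → w = 0) ∧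
      ∀ U ∈ 𝓝 (0 : Fin n → K), y '' (W ∩ U) ∈ 𝓝 0 := by
  induction n with
  | zero =>
    refine ⟨0, LinearMap.id, Eventually.of_forall fun w _ _ => Subsingleton.elim _ _,
      fun U hU => ?_⟩
    refine Filter.mem_of_superset Filter.univ_mem fun x _ => ?_
    exact ⟨0, ⟨h0, mem_of_mem_nhds hU⟩, Subsingleton.elim _ _⟩
  | succ n ih =>
    by_cases hall : ∀ᶠ w in 𝓝 0, w ∈ W
    · refine ⟨n + 1, LinearMap.id, Eventually.of_forall fun w _ h => h, fun U hU => ?_⟩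
      rw [LinearMap.id_coe, Set.image_id]
      exact Filter.inter_mem hall hU
    obtain ⟨s, F, hF, hWF⟩ := id hW
    obtain ⟨j, hj⟩ : ∃ j, ∃ᶠ w in 𝓝 0, F j w ≠ 0 := by
      rw [← frequently_exists]
      refine ((not_eventually.1 hall).and_eventually hWF).mono fun w hw => ?_
      rw [hw.2] at hw
      push Not at hw
      exact hw.1
    obtain ⟨v, hFv, hv⟩ := (hF j).exists_line hj
    have hv0 : v ≠ 0 := by
      rintro rfl
      exact hFv (hWF.self_of_nhds.1 h0 j)
    -- A line that does not lie in `W` near 0 is made the first axis, so that one variable can be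
    -- eliminated.
    obtain ⟨φ, hφ⟩ := exists_linearEquiv_single_eq hv0
    have hφt : Tendsto φ (𝓝 0) (𝓝 0) :=
      φ.toLinearMap.continuous_on_pi.tendsto' 0 0 (map_zero φ)
    have hφs : Tendsto φ.symm (𝓝 0) (𝓝 0) :=
      φ.symm.toLinearMap.continuous_on_pi.tendsto' 0 0 (map_zero φ.symm)
    have hreg : ∃ᶠ z in 𝓝 (0 : K), (Pi.single 0 z : Fin (n + 1) → K) ∉ φ ⁻¹' W := by
      have hzv : Tendsto (fun z : K => z • v) (𝓝 0) (𝓝 0) :=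
        (continuous_id.smul continuous_const).tendsto' 0 0 (zero_smul K v)
      refine (hv.and_eventually (hzv.eventually hWF)).mono fun z hz hmem => ?_
      rw [Set.mem_preimage, hφ, hz.2] at hmem
      exact hz.1 (hmem j)
    obtain ⟨W', hW', hlift, htail, hfib, -⟩ :=
      (hW.preimage (φ : (Fin (n + 1) → K) →ₗ[K] _)).exists_projection hreg
    have h0' : (0 : Fin n → K) ∈ W' := htail.self_of_nhds (by simpa using h0)
    obtain ⟨e, y, hy, hopen⟩ := ih hW' h0'
    refine ⟨e, (y.comp (tailLinear K n)).comp (φ.symm : _ →ₗ[K] _), ?_, fun U hU => ?_⟩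
    · filter_upwards [hφs.eventually htail, hφs.eventually hfib,
        hφs.eventually (tail_tendsto.eventually hy)] with w h1 h2 h3 hw hyw
      have hw' : φ.symm w ∈ φ ⁻¹' W := by simpa using hw
      have := h2 hw' (h3 (h1 hw') hyw)
      simpa using this
    · have hU' := hlift _ (hφt hU)
      refine Filter.mem_of_superset (hopen _ hU') ?_
      rintro _ ⟨x, ⟨hxW, hx⟩, rfl⟩
      obtain ⟨w, ⟨hw, hwU⟩, rfl⟩ := hx hxW
      exact ⟨φ w, ⟨hw, hwU⟩, by simp [tailLinear_apply]⟩

/-- If a linear projection `y` has finite fibres on a zero locus at the origin, then the analytic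
functions on the locus are a finite module over the analytic functions of `y`. -/
theorem IsZeroLocusGerm.exists_generators {W : Set (Fin n → K)} (hW : IsZeroLocusGerm W) {e : ℕ}
    (y : (Fin n → K) →ₗ[K] (Fin e → K)) (hy : ∀ᶠ w in 𝓝 0, w ∈ W → y w = 0 → w = 0) :
    ∃ (ι : Type) (_ : Fintype ι) (m : ι → (Fin n → K) → K), (∀ i, IsAnalyticGerm (m i)) ∧
      ∀ g, IsAnalyticGerm g → ∃ c : ι → (Fin e → K) → K, (∀ i, IsAnalyticGerm (c i)) ∧
        ∀ᶠ w in 𝓝 0, w ∈ W → g w = ∑ i, c i (y w) * m i w := by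
  induction n with
  | zero =>
    refine ⟨Unit, inferInstance, fun _ _ => 1, fun _ => .const 1, fun g hg =>
      ⟨fun _ _ => g 0, fun _ => .const _, Eventually.of_forall fun w _ => ?_⟩⟩
    simp [Subsingleton.elim w 0]
  | succ n ih =>
    by_cases hinj : LinearMap.ker y = ⊥
    · obtain ⟨s, hs⟩ := y.exists_leftInverse_of_injective hinj
      refine ⟨Unit, inferInstance, fun _ _ => 1, fun _ => .const 1, fun g hg =>
        ⟨fun _ x => g (s x), fun _ => hg.comp_linear s, Eventually.of_forall fun w _ => ?_⟩⟩
      have : s (y w) = w := LinearMap.congr_fun hs w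
      simp [this]
    -- A kernel vector of `y` spans a line that meets `W` near 0 at most in the origin, so
    -- elimination along it is allowed, and `y` factors through the remaining coordinates.
    obtain ⟨v, hvy, hv0⟩ := Submodule.exists_mem_ne_zero_of_ne_bot hinj
    rw [LinearMap.mem_ker] at hvy
    obtain ⟨φ, hφ⟩ := exists_linearEquiv_single_eq hv0
    have hφt : Tendsto φ (𝓝 0) (𝓝 0) :=
      φ.toLinearMap.continuous_on_pi.tendsto' 0 0 (map_zero φ)
    have hφs : Tendsto φ.symm (𝓝 0) (𝓝 0) :=
      φ.symm.toLinearMap.continuous_on_pi.tendsto' 0 0 (map_zero φ.symm)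
    have hreg : ∃ᶠ z in 𝓝 (0 : K), (Pi.single 0 z : Fin (n + 1) → K) ∉ φ ⁻¹' W := by
      have hzv : Tendsto (fun z : K => z • v) (𝓝 0) (𝓝 0) :=
        (continuous_id.smul continuous_const).tendsto' 0 0 (zero_smul K v)
      have : ∀ᶠ z in 𝓝[≠] (0 : K), (Pi.single 0 z : Fin (n + 1) → K) ∉ φ ⁻¹' W := by
        filter_upwards [self_mem_nhdsWithin, nhdsWithin_le_nhds (hzv.eventually hy)] with z h1 h2 h3
        rw [Set.mem_preimage, hφ] at h3
        exact smul_ne_zero h1 hv0 (h2 h3 (by rw [map_smul, hvy, smul_zero]))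
      exact this.frequently.filter_mono nhdsWithin_le_nhds
    obtain ⟨W', hW', hlift, htail, -, d, hdiv⟩ :=
      (hW.preimage (φ : (Fin (n + 1) → K) →ₗ[K] _)).exists_projection hreg
    obtain ⟨y', hy'⟩ := exists_comp_tail (y.comp (φ : (Fin (n + 1) → K) →ₗ[K] _)) fun z => by
      simp [hφ, hvy]
    have hy'' : ∀ w, y (φ w) = y' (Fin.tail w) := hy'
    have hiso : ∀ᶠ x in 𝓝 0, x ∈ W' → y' x = 0 → x = 0 := by
      filter_upwards [hlift _ (hφt hy)] with x hx hxW hyx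
      obtain ⟨w, ⟨hw, hwU⟩, rfl⟩ := hx hxW
      have h1 : φ w = 0 := hwU hw (by rw [hy'', hyx])
      rw [φ.map_eq_zero_iff.1 h1]
      rfl
    obtain ⟨ι, _, m, hm, hgen⟩ := ih hW' y' hiso
    -- Generators downstairs times the powers below `d` of the eliminated coordinate.
    refine ⟨ι × Fin d, inferInstance,
      fun i w => m i.1 (Fin.tail (φ.symm w)) * φ.symm w 0 ^ (i.2 : ℕ), fun i => ?_, fun g hg => ?_⟩
    · have h1 := (((hm i.1).comp_linear (tailLinear K n)).mul
        ((IsAnalyticGerm.coord 0).pow (i.2 : ℕ))).comp_linear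
        (φ.symm : (Fin (n + 1) → K) →ₗ[K] _)
      exact h1
    · obtain ⟨r, hr, hgr⟩ := hdiv _ (hg.comp_linear (φ : (Fin (n + 1) → K) →ₗ[K] _))
      choose c hc hrc using fun k => hgen (r k) (hr k)
      refine ⟨fun i => c i.2 i.1, fun i => hc _ _, ?_⟩
      filter_upwards [hφs.eventually hgr, hφs.eventually htail, hφs.eventually
        (tail_tendsto.eventually (eventually_all.2 fun k : Fin d => hrc k))] with w h1 h2 h3 hw
      have hw' : φ.symm w ∈ φ ⁻¹' W := by simpa using hw
      have hyw : y' (Fin.tail (φ.symm w)) = y w := by rw [← hy'', φ.apply_symm_apply]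
      have h4 := h1 hw'
      simp only [LinearEquiv.coe_coe, φ.apply_symm_apply] at h4
      rw [h4, Fintype.sum_prod_type_right, Finset.sum_range]
      refine Finset.sum_congr rfl fun k _ => ?_
      rw [h3 k (h2 hw'), hyw, Finset.sum_mul]
      exact Finset.sum_congr rfl fun i _ => by ring

end LinearProjections

/-! ### The counting argument -/

section Counting
variable {K : Type*} [NontriviallyNormedField K] {e : ℕ} {X ι : Type*} [Fintype ι]

/-- On `S` the function `h` is a combination of the functions `μ i`, whose coefficients are analytic
functions of `y` on the closed ball of radius `‖c‖` that are bounded by `C`. -/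
def IsBoundedCombination (c : K) (S : Set X) (y : X → Fin e → K) (μ : ι → X → K) (h : X → K)
    (C : ℝ) : Prop :=
  ∃ v : ι → (Fin e → K) → K, (∀ i, IsPolyLimitOn (Metric.closedBall 0 ‖c‖) (v i)) ∧
    (∀ i x, ‖x‖ ≤ ‖c‖ → ‖v i x‖ ≤ C) ∧ ∀ w ∈ S, h w = ∑ i, v i (y w) * μ i w

variable {c : K} {S : Set X} {y : X → Fin e → K} {μ : ι → X → K} {h k : X → K} {C M : ℝ}

theorem IsBoundedCombination.congr (hh : IsBoundedCombination c S y μ h C)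
    (hk : ∀ w ∈ S, k w = h w) : IsBoundedCombination c S y μ k C := by
  obtain ⟨v, h1, h2, h3⟩ := hh
  exact ⟨v, h1, h2, fun w hw => (hk w hw).trans (h3 w hw)⟩

variable [IsUltrametricDist K]

/-- The function `k` acts on the generators through the matrix `L`. By the ultrametric inequality
the bound grows only by `M`, with no factor for the number of generators, so it is exponential in
the degree of a monomial. -/
theorem IsBoundedCombination.mul (hh : IsBoundedCombination c S y μ h C) (hC : 0 ≤ C) (hM : 0 ≤ M)
    {L : ι → ι → (Fin e → K) → K}
    (hL : ∀ j i, IsPolyLimitOn (Metric.closedBall 0 ‖c‖) (L j i))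
    (hLM : ∀ j i x, ‖x‖ ≤ ‖c‖ → ‖L j i x‖ ≤ M)
    (hk : ∀ w ∈ S, ∀ j, k w * μ j w = ∑ i, L j i (y w) * μ i w) :
    IsBoundedCombination c S y μ (fun w => k w * h w) (M * C) := by
  obtain ⟨v, h1, h2, h3⟩ := hh
  refine ⟨fun i x => ∑ j, v j x * L j i x, fun i => ?_, fun i x hx => ?_, fun w hw => ?_⟩
  · exact .sum _ fun j _ => (h1 j).mul (hL j i) fun x hx => mem_closedBall_zero_iff.1 hx
  · refine IsUltrametricDist.norm_sum_le_of_forall_le_of_nonneg (by positivity) fun j _ => ?_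
    rw [norm_mul, mul_comm M]
    exact mul_le_mul (h2 j x hx) (hLM j i x hx) (norm_nonneg _) hC
  · have h4 : ∀ j, k w * (v j (y w) * μ j w) = ∑ i, v j (y w) * L j i (y w) * μ i w := fun j => by
      rw [mul_left_comm, hk w hw j, Finset.mul_sum]
      exact Finset.sum_congr rfl fun i _ => by ring
    simp_rw [h3 w hw, Finset.mul_sum, h4, Finset.sum_mul]
    exact Finset.sum_comm

theorem IsBoundedCombination.prod {m : ℕ} {H : Fin m → X → K}
    (h1 : IsBoundedCombination c S y μ (fun _ => 1) C) (hC : 0 ≤ C) (hM : 0 ≤ M)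
    {L : Fin m → ι → ι → (Fin e → K) → K}
    (hL : ∀ a j i, IsPolyLimitOn (Metric.closedBall 0 ‖c‖) (L a j i))
    (hLM : ∀ a j i x, ‖x‖ ≤ ‖c‖ → ‖L a j i x‖ ≤ M)
    (hH : ∀ a, ∀ w ∈ S, ∀ j, H a w * μ j w = ∑ i, L a j i (y w) * μ i w) (t : Fin m → ℕ) :
    IsBoundedCombination c S y μ (fun w => ∏ a, H a w ^ t a) (M ^ (∑ a, t a) * C) := by
  classical
  have : ∀ s : Finset (Fin m),
      IsBoundedCombination c S y μ (fun w => ∏ a ∈ s, H a w ^ t a) (M ^ (∑ a ∈ s, t a) * C) := by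
    intro s
    induction s using Finset.induction_on with
    | empty => simpa using h1
    | insert a s ha ih =>
      have hpow : ∀ r : ℕ, IsBoundedCombination c S y μ
          (fun w => H a w ^ r * ∏ a ∈ s, H a w ^ t a) (M ^ (r + ∑ a ∈ s, t a) * C) := by
        intro r
        induction r with
        | zero => simpa using ih
        | succ r ihr =>
          have := ihr.mul (by positivity) hM (hL a) (hLM a) (hH a)
          rw [← mul_assoc, ← pow_succ', add_right_comm] at this
          exact this.congr fun w _ => by ring
      simpa [Finset.prod_insert ha, Finset.sum_insert ha] using hpow (t a)
  exact this _

variable [IsAlgClosed K] [CompleteSpace K]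

/-- Among more than `card ι * k ^ e` bounded combinations some nontrivial normalized linear
combination has order at least `k` in `y`, hence is small on a smaller ball. -/
theorem exists_small_combination (hc : c ≠ 0) (hy : ∀ w ∈ S, ‖y w‖ ≤ 1 / 2 * ‖c‖)
    {B : ℝ} (hB : 0 ≤ B) (hμ : ∀ i, ∀ w ∈ S, ‖μ i w‖ ≤ B) {A : Type*} [Fintype A]
    {g : A → X → K} (hC : 0 ≤ C) (hg : ∀ α, IsBoundedCombination c S y μ (g α) C) {k : ℕ}
    (hcard : Fintype.card ι * k ^ e < Fintype.card A) :
    ∃ (b : A → K) (α₀ : A), b α₀ = 1 ∧ ∀ w ∈ S, ‖∑ α, b α * g α w‖ ≤ C * (1 / 2) ^ k * B := by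
  classical
  choose v hv hvC hgv using hg
  choose a ha using fun α i => (hv α i).exists_hasCoeffs hc
  -- For each generator these are the Taylor coefficients with all exponents below `k`. They number
  -- `k ^ e` and include every coefficient of total degree less than `k`.
  let Λ : (A → K) →ₗ[K] (ι × (Fin e → Fin k) → K) :=
    { toFun := fun b i => ∑ α, b α * a α i.1 (Finsupp.equivFunOnFinite.symm fun j => (i.2 j : ℕ))
      map_add' := fun b b' => by ext i; simp [add_mul, Finset.sum_add_distrib]
      map_smul' := fun r b => by ext i; simp [mul_assoc, Finset.mul_sum] }
  have hker : LinearMap.ker Λ ≠ ⊥ := LinearMap.ker_ne_bot_of_finrank_lt (by simpa using hcard)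
  obtain ⟨b, hb, hb0⟩ := Submodule.exists_mem_ne_zero_of_ne_bot hker
  obtain ⟨α₁, hα₁⟩ := Function.ne_iff.1 hb0
  obtain ⟨α₀, -, hmax⟩ := Finset.exists_max_image Finset.univ (fun α => ‖b α‖)
    ⟨α₁, Finset.mem_univ _⟩
  have hb₀ : 0 < ‖b α₀‖ := (norm_pos_iff.2 hα₁).trans_le (hmax α₁ (Finset.mem_univ _))
  -- Dividing by the largest coefficient keeps all norms at most 1, as the upper bound needs, and
  -- makes one coefficient equal to 1, as the later lower bound needs.
  set b' : A → K := (b α₀)⁻¹ • b with hb'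
  have hb'1 : ∀ α, ‖b' α‖ ≤ 1 := fun α => by
    rw [hb', Pi.smul_apply, norm_smul, norm_inv, inv_mul_le_iff₀ hb₀, mul_one]
    exact hmax α (Finset.mem_univ _)
  have hb'k : Λ b' = 0 := by
    rw [hb', map_smul, LinearMap.mem_ker.1 hb, smul_zero]
  refine ⟨b', α₀, inv_mul_cancel₀ (norm_pos_iff.1 hb₀), fun w hw => ?_⟩
  have hφ : ∀ i x, ‖x‖ ≤ 1 / 2 * ‖c‖ → ‖∑ α, b' α * v α i x‖ ≤ C * (1 / 2) ^ k := by
    intro i x hx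
    refine (HasCoeffs.sum Finset.univ fun α _ => (ha α i).const_mul (b' α)).norm_le_mul_pow
      (φ := fun x => ∑ α, b' α * v α i x) (fun x hx => ?_) (fun t ht => ?_) (by norm_num)
      (by norm_num) hx
    · refine IsUltrametricDist.norm_sum_le_of_forall_le_of_nonneg hC fun α _ => ?_
      rw [norm_mul]
      exact (mul_le_of_le_one_left (norm_nonneg _) (hb'1 α)).trans (hvC α i x hx)
    · have htk : ∀ j, t j < k := fun j => (Finsupp.le_degree j t).trans_lt ht
      have h1 := congrFun hb'k (i, fun j => ⟨t j, htk j⟩)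
      have h2 : Finsupp.equivFunOnFinite.symm (fun j => t j) = t := by ext; simp
      simpa [Λ, h2] using h1
  have hsum : ∑ α, b' α * g α w = ∑ i, (∑ α, b' α * v α i (y w)) * μ i w := by
    simp_rw [hgv _ w hw, Finset.mul_sum, Finset.sum_mul]
    rw [Finset.sum_comm]
    exact Finset.sum_congr rfl fun i _ => Finset.sum_congr rfl fun α _ => by ring
  rw [hsum]
  refine IsUltrametricDist.norm_sum_le_of_forall_le_of_nonneg (by positivity) fun i _ => ?_
  rw [norm_mul]
  exact mul_le_mul (hφ i _ (hy w hw)) (hμ i w hw) (norm_nonneg _) (by positivity)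

/-- Functions that act on a finite module over the analytic functions of `e` variables do not
take all values in a ball of dimension greater than `e`. -/
theorem not_closedBall_subset_image (hc : c ≠ 0) (hy : ∀ w ∈ S, ‖y w‖ ≤ 1 / 2 * ‖c‖)
    {B : ℝ} (hB : 0 ≤ B) (hμ : ∀ i, ∀ w ∈ S, ‖μ i w‖ ≤ B) {m : ℕ} (hm : e < m)
    {H : Fin m → X → K} {u : ι → (Fin e → K) → K}
    (hu : ∀ i, IsPolyLimitOn (Metric.closedBall 0 ‖c‖) (u i))
    (hu1 : ∀ w ∈ S, 1 = ∑ i, u i (y w) * μ i w)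
    {L : Fin m → ι → ι → (Fin e → K) → K}
    (hL : ∀ a j i, IsPolyLimitOn (Metric.closedBall 0 ‖c‖) (L a j i))
    (hH : ∀ a, ∀ w ∈ S, ∀ j, H a w * μ j w = ∑ i, L a j i (y w) * μ i w)
    {r : K} (hr : r ≠ 0) : ¬ Metric.closedBall 0 ‖r‖ ⊆ (fun w a => H a w) '' S := by
  classical
  intro hsub
  wlog hr1 : ‖r‖ ≤ 1 generalizing r
  · exact this (r := 1) one_ne_zero ((Metric.closedBall_subset_closedBall (by
      rw [norm_one]; linarith)).trans hsub) (by simp)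
  have hrp : 0 < ‖r‖ := norm_pos_iff.2 hr
  obtain ⟨C, hC, hCu⟩ : ∃ C, 0 ≤ C ∧ ∀ i x, ‖x‖ ≤ ‖c‖ → ‖u i x‖ ≤ C := by
    choose C hC h using fun i => (hu i).exists_norm_le fun x hx => mem_closedBall_zero_iff.1 hx
    refine ⟨∑ i, C i, Finset.sum_nonneg fun i _ => hC i, fun i x hx => ?_⟩
    exact (h i x (mem_closedBall_zero_iff.2 hx)).trans
      (Finset.single_le_sum (fun i _ => hC i) (Finset.mem_univ i))
  obtain ⟨M, hM, hML⟩ : ∃ M, 1 ≤ M ∧ ∀ a j i x, ‖x‖ ≤ ‖c‖ → ‖L a j i x‖ ≤ M := by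
    choose C hC h using fun q : Fin m × ι × ι =>
      (hL q.1 q.2.1 q.2.2).exists_norm_le fun x hx => mem_closedBall_zero_iff.1 hx
    refine ⟨1 + ∑ q, C q, le_add_of_nonneg_right (Finset.sum_nonneg fun i _ => hC i),
      fun a j i x hx => ?_⟩
    have := Finset.single_le_sum (fun i _ => hC i) (Finset.mem_univ (a, j, i))
    have := h (a, j, i) x (mem_closedBall_zero_iff.2 hx)
    simp only at *
    linarith
  -- Vanishing to order `N * T` gains `2 ^ (N * T)`, which must beat both the growth `M ^ (m * T)`
  -- and the loss `‖r‖ ^ (m * T)`. Hence `N` is fixed before `T`.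
  obtain ⟨N, hN⟩ : ∃ N : ℕ, 1 + C * B < 2 ^ N * (‖r‖ ^ m / M ^ m) := by
    obtain ⟨N, hN⟩ := pow_unbounded_of_one_lt ((1 + C * B) / (‖r‖ ^ m / M ^ m)) one_lt_two
    exact ⟨N, (div_lt_iff₀ (by positivity)).1 hN⟩
  -- There are `T ^ m` monomials with exponents below `T`, against `card ι * (N * T) ^ e`
  -- conditions. As `m` is at least `e + 1`, it is enough that `T` exceeds `card ι * N ^ e`.
  set T := Fintype.card ι * N ^ e + 1 with hT
  have hcard : Fintype.card ι * (N * T) ^ e < Fintype.card (Fin m → Fin T) := by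
    rw [Fintype.card_fun, Fintype.card_fin, Fintype.card_fin]
    calc Fintype.card ι * (N * T) ^ e = (Fintype.card ι * N ^ e) * T ^ e := by
          rw [mul_pow, mul_assoc]
      _ < T * T ^ e := Nat.mul_lt_mul_of_pos_right (by omega) (by positivity)
      _ = T ^ (e + 1) := (pow_succ' T e).symm
      _ ≤ T ^ m := Nat.pow_le_pow_right (by omega) hm
  have hdeg : ∀ α : Fin m → Fin T, ∑ a, (α a : ℕ) ≤ m * T := fun α => by
    simpa using Finset.sum_le_sum fun a (_ : a ∈ Finset.univ) => (α a).2.le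
  have hcomb : ∀ α : Fin m → Fin T, IsBoundedCombination c S y μ
      (fun w => ∏ a, H a w ^ (α a : ℕ)) (M ^ (m * T) * C) := by
    intro α
    obtain ⟨v, h1, h2, h3⟩ := IsBoundedCombination.prod ⟨u, hu, hCu, hu1⟩ hC (by positivity)
      hL hML hH fun a => (α a : ℕ)
    exact ⟨v, h1, fun i x hx => (h2 i x hx).trans (mul_le_mul_of_nonneg_right
      (pow_le_pow_right₀ hM (hdeg α)) hC), h3⟩
  obtain ⟨b, α₀, hb, hsmall⟩ := exists_small_combination hc hy hB hμ (by positivity) hcomb hcard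
  let mon : (Fin m → Fin T) → (Fin m →₀ ℕ) := fun α =>
    Finsupp.equivFunOnFinite.symm fun a => (α a : ℕ)
  have hmon : Function.Injective mon := by
    intro α β h
    ext a
    exact DFunLike.congr_fun h a
  let G : MvPolynomial (Fin m) K := ∑ α, MvPolynomial.monomial (mon α) (b α)
  have hGc : G.coeff (mon α₀) = 1 := by
    simp [G, MvPolynomial.coeff_sum, MvPolynomial.coeff_monomial, hmon.eq_iff, hb]
  have hGe : ∀ x, MvPolynomial.eval x G = ∑ α, b α * ∏ a, x a ^ (α a : ℕ) := by
    intro x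
    simp [G, mon, MvPolynomial.eval_monomial, Finsupp.prod_fintype]
  have hgauss := norm_mvCoeff_mul_pow_le G r (C := M ^ (m * T) * C * (1 / 2) ^ (N * T) * B)
    (fun x hx => by
      obtain ⟨w, hw, rfl⟩ := hsub (mem_closedBall_zero_iff.2 hx)
      rw [hGe]
      exact hsmall w hw) (mon α₀)
  rw [hGc, norm_one, one_mul] at hgauss
  have h1 : ‖r‖ ^ (m * T) ≤ ‖r‖ ^ (mon α₀).degree := by
    refine pow_le_pow_of_le_one hrp.le hr1 ?_
    rw [Finsupp.degree_eq_sum]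
    exact hdeg α₀
  have h2 : (2 ^ N * (‖r‖ ^ m / M ^ m)) ^ T ≤ C * B := by
    have h3 := h1.trans hgauss
    rw [mul_pow, div_pow, ← pow_mul, ← pow_mul, ← pow_mul, mul_div_assoc',
      div_le_iff₀ (by positivity)]
    rw [one_div, inv_pow] at h3
    have h4 := mul_le_mul_of_nonneg_left h3 (show (0 : ℝ) ≤ 2 ^ (N * T) by positivity)
    refine h4.trans (le_of_eq ?_)
    field_simp
  have hCB : 0 ≤ C * B := by positivity
  have h5 : 2 ^ N * (‖r‖ ^ m / M ^ m) ≤ (2 ^ N * (‖r‖ ^ m / M ^ m)) ^ T :=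
    le_self_pow₀ (by linarith) (by omega)
  linarith

/-- If a linear projection to dimension `e` has finite fibres on a zero locus at the origin, then
near the origin the images of the locus in larger dimension have no interior. -/
theorem IsZeroLocusGerm.exists_interior_image_eq_empty {n : ℕ} {W : Set (Fin n → K)}
    (hW : IsZeroLocusGerm W)
    (y : (Fin n → K) →ₗ[K] (Fin e → K)) (hy : ∀ᶠ w in 𝓝 0, w ∈ W → y w = 0 → w = 0) :
    ∃ U ∈ 𝓝 (0 : Fin n → K), ∀ m, e < m → ∀ l : (Fin n → K) →ₗ[K] (Fin m → K),
      interior (l '' (W ∩ U)) = ∅ := by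
  classical
  obtain ⟨ι, _, μ, hμ, hgen⟩ := hW.exists_generators y hy
  obtain ⟨u, hu, hu1⟩ := hgen _ (.const 1)
  choose L hL hLe using fun (q : Fin n × ι) => hgen _ ((IsAnalyticGerm.coord q.1).mul (hμ q.2))
  choose B hB hBμ using fun i => (hμ i).exists_norm_le
  choose δ hδ hδu using hu
  choose δ' hδ' hδL using hL
  obtain ⟨ε, hε, hεu, hεL⟩ : ∃ ε > 0, (∀ i, ε ≤ δ i) ∧ ∀ q i, ε ≤ δ' q i := by
    have h1 : ∀ᶠ ε in 𝓝[>] (0 : ℝ), (∀ i, ε ≤ δ i) ∧ ∀ q i, ε ≤ δ' q i := by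
      refine Filter.Eventually.and (eventually_all.2 fun i => ?_)
        (eventually_all.2 fun q => eventually_all.2 fun i => ?_)
      · exact nhdsWithin_le_nhds (eventually_le_nhds (hδ i))
      · exact nhdsWithin_le_nhds (eventually_le_nhds (hδ' q i))
    obtain ⟨ε, h, hε⟩ := (h1.and self_mem_nhdsWithin).exists
    exact ⟨ε, hε, h⟩
  obtain ⟨c, hc0, hc⟩ := NormedField.exists_norm_lt K hε
  have hyt : ∀ᶠ w in 𝓝 0, y w ∈ Metric.closedBall 0 (1 / 2 * ‖c‖) :=
    (y.continuous_on_pi.tendsto' 0 0 (map_zero y)).eventually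
      (Metric.closedBall_mem_nhds _ (by positivity))
  obtain ⟨U, hU, hUw⟩ := eventually_iff_exists_mem.1
    (hyt.and (hu1.and ((eventually_all.2 hLe).and (eventually_all.2 hBμ))))
  refine ⟨U, hU, fun m hm l => ?_⟩
  by_contra hne
  obtain ⟨u₀, hu₀⟩ := Set.nonempty_iff_ne_empty.2 hne
  obtain ⟨ρ, hρ, hball⟩ := Metric.nhds_basis_closedBall.mem_iff.1 (mem_interior_iff_mem_nhds.1 hu₀)
  obtain ⟨r, hr0, hr⟩ := NormedField.exists_norm_lt K hρ
  -- Subtracting the interior point `u₀` centres the ball at 0. The matrix `L` combines the actions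
  -- of the coordinates on the generators, with the constant `-u₀ a` on the diagonal.
  refine not_closedBall_subset_image (c := c) (S := W ∩ U) (y := y) (μ := μ)
    (B := ∑ i, B i) (H := fun a w => l w a - u₀ a) (u := u)
    (L := fun a j i x => ∑ b, l (Pi.single b 1) a * L (b, j) i x + (if j = i then -u₀ a else 0))
    (norm_pos_iff.1 hc0) (fun w hw => mem_closedBall_zero_iff.1 (hUw w hw.2).1)
    (Finset.sum_nonneg fun i _ => hB i) (fun i w hw => ((hUw w hw.2).2.2.2 i).trans
      (Finset.single_le_sum (fun i _ => hB i) (Finset.mem_univ i))) hm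
    (fun i => (hδu i).mono (Metric.closedBall_subset_closedBall (hc.le.trans (hεu i))))
    (fun w hw => (hUw w hw.2).2.1 hw.1) (fun a j i => ?_) (fun a w hw j => ?_) (norm_pos_iff.1 hr0) ?_
  · refine (IsPolyLimitOn.sum _ fun b _ => ((hδL (b, j) i).mono
      (Metric.closedBall_subset_closedBall (hc.le.trans (hεL _ i)))).const_mul _).add ?_
    simpa using IsPolyLimitOn.eval (MvPolynomial.C (if j = i then -u₀ a else 0))
  · have h1 : l w a = ∑ b, w b * l (Pi.single b 1) a := by
      rw [LinearMap.pi_apply_eq_sum_univ l w]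
      simp only [Finset.sum_apply, Pi.smul_apply, smul_eq_mul]
      refine Finset.sum_congr rfl fun b _ => ?_
      have : (Pi.single b 1 : Fin n → K) = fun k => if b = k then 1 else 0 := by
        ext k
        simp [Pi.single_apply, eq_comm]
      rw [this]
    have h2 : ∀ b, w b * l (Pi.single b 1) a * μ j w
        = ∑ i, l (Pi.single b 1) a * L (b, j) i (y w) * μ i w := fun b => by
      have := (hUw w hw.2).2.2.1 (b, j) hw.1
      simp only at this
      rw [mul_right_comm, this, Finset.sum_mul]
      exact Finset.sum_congr rfl fun i _ => by ring
    simp_rw [sub_mul, h1, Finset.sum_mul, h2, add_mul, Finset.sum_add_distrib, ite_mul, zero_mul]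
    rw [Finset.sum_ite_eq, if_pos (Finset.mem_univ _), neg_mul, ← sub_eq_add_neg, Finset.sum_comm]
    simp_rw [Finset.sum_mul]
  · intro x hx
    have hx' : x + u₀ ∈ Metric.closedBall u₀ ρ := by
      rw [mem_closedBall_iff_norm, add_sub_cancel_right]
      exact (mem_closedBall_zero_iff.1 hx).trans hr.le
    obtain ⟨w, hw, hwx⟩ := hball hx'
    refine ⟨w, hw, funext fun a => ?_⟩
    simp [hwx]

end Counting

/-! ### Linear maps to and from products -/

section AppendLinear
variable {K : Type*} [NontriviallyNormedField K] {E : Type*} [AddCommGroup E] [Module K E]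

/-- The linear map with components `f` and `g`. -/
def appendLinear {a b : ℕ} (f : E →ₗ[K] (Fin a → K)) (g : E →ₗ[K] (Fin b → K)) :
    E →ₗ[K] (Fin (a + b) → K) where
  toFun w := Fin.append (f w) (g w)
  map_add' v w := by
    ext i
    refine Fin.addCases (fun j => ?_) (fun j => ?_) i <;> simp
  map_smul' r w := by
    ext i
    refine Fin.addCases (fun j => ?_) (fun j => ?_) i <;> simp

theorem appendLinear_apply {a b : ℕ} (f : E →ₗ[K] (Fin a → K)) (g : E →ₗ[K] (Fin b → K)) (w : E) :
    appendLinear f g w = Fin.append (f w) (g w) := rfl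

/-- The first `a` of `a + b` coordinates. -/
def fstLinear (K : Type*) [NontriviallyNormedField K] (a b : ℕ) :
    (Fin (a + b) → K) →ₗ[K] (Fin a → K) :=
  LinearMap.funLeft K K (Fin.castAdd b)

/-- The last `b` of `a + b` coordinates. -/
def sndLinear (K : Type*) [NontriviallyNormedField K] (a b : ℕ) :
    (Fin (a + b) → K) →ₗ[K] (Fin b → K) :=
  LinearMap.funLeft K K (Fin.natAdd a)

theorem append_fstLinear_sndLinear {a b : ℕ} (w : Fin (a + b) → K) :
    Fin.append (fstLinear K a b w) (sndLinear K a b w) = w :=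
  Fin.append_castAdd_natAdd

theorem fstLinear_append {a b : ℕ} (u : Fin a → K) (v : Fin b → K) :
    fstLinear K a b (Fin.append u v) = u :=
  funext fun i => Fin.append_left u v i

theorem sndLinear_append {a b : ℕ} (u : Fin a → K) (v : Fin b → K) :
    sndLinear K a b (Fin.append u v) = v :=
  funext fun i => Fin.append_right u v i

end AppendLinear

/-! ### Analytic sets over ℂ_[p] and the dimension inequality -/

variable {p : ℕ} [Fact p.Prime] {n : ℕ}

/-- Strict convergence leaves only finitely many terms of size at least ε on the box; they form the
approximating polynomial, and the ultrametric inequality bounds the sum of the others by ε. -/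
theorem isAnalyticGerm_evalAround {c : Fin n → ℂ_[p]} (hc : ∀ i, c i ≠ 0)
    {f : MvPowerSeries (Fin n) ℂ_[p]} (hf : MvPowerSeries.IsRestricted (fun i => ‖c i‖) f)
    (x : Fin n → ℂ_[p]) : IsAnalyticGerm fun h => evalAround f x (x + h) := by
  obtain ⟨δ, hδ, hδc⟩ : ∃ δ > 0, ∀ i, δ ≤ ‖c i‖ := by
    have h1 : ∀ᶠ δ in 𝓝[>] (0 : ℝ), ∀ i, δ ≤ ‖c i‖ := eventually_all.2 fun i =>
      nhdsWithin_le_nhds (eventually_le_nhds (norm_pos_iff.2 (hc i)))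
    obtain ⟨δ, h, hδ⟩ := (h1.and self_mem_nhdsWithin).exists
    exact ⟨δ, hδ, h⟩
  refine ⟨δ, hδ, fun ε hε => ?_⟩
  have hfin : {t | ¬ ‖MvPowerSeries.coeff t f‖ * t.prod (‖c ·‖ ^ ·) < ε}.Finite :=
    Filter.eventually_cofinite.1 (hf.eventually (gt_mem_nhds hε))
  refine ⟨∑ t ∈ hfin.toFinset, MvPolynomial.monomial t (MvPowerSeries.coeff t f), fun h hh => ?_⟩
  have hterm : ∀ t, ‖MvPowerSeries.coeff t f * ∏ i, h i ^ t i‖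
      ≤ ‖MvPowerSeries.coeff t f‖ * t.prod (‖c ·‖ ^ ·) := by
    intro t
    rw [norm_mul, norm_prod, Finsupp.prod_fintype _ _ fun _ => pow_zero _]
    refine mul_le_mul_of_nonneg_left (Finset.prod_le_prod (fun _ _ => norm_nonneg _) fun i _ => ?_)
      (norm_nonneg _)
    rw [norm_pow]
    exact pow_le_pow_left₀ (norm_nonneg _)
      (((norm_le_pi_norm h i).trans (mem_closedBall_zero_iff.1 hh)).trans (hδc i)) _
  have hsum : Summable fun t => MvPowerSeries.coeff t f * ∏ i, h i ^ t i :=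
    NonarchimedeanAddGroup.summable_of_tendsto_cofinite_zero (squeeze_zero_norm hterm hf)
  have e1 : evalAround f x (x + h) = ∑' t, MvPowerSeries.coeff t f * ∏ i, h i ^ t i := by
    simp [evalAround]
  have e2 : MvPolynomial.eval h (∑ t ∈ hfin.toFinset,
      MvPolynomial.monomial t (MvPowerSeries.coeff t f))
      = ∑ t ∈ hfin.toFinset, MvPowerSeries.coeff t f * ∏ i, h i ^ t i := by
    simp [MvPolynomial.eval_monomial, Finsupp.prod_fintype]
  simp only [e1]
  rw [e2, ← hsum.sum_add_tsum_compl (s := hfin.toFinset), add_sub_cancel_left]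
  refine IsUltrametricDist.norm_tsum_le_of_forall_le_of_nonneg hε.le fun t => ?_
  have ht : (t : Fin n →₀ ℕ) ∉ hfin.toFinset := t.2
  rw [Set.Finite.mem_toFinset, Set.mem_ofPred_eq, not_not] at ht
  exact (hterm t).trans ht.le

theorem IsAnalytic.isZeroLocusGerm {X : Set (Fin n → ℂ_[p])} (hX : IsAnalytic X)
    {x : Fin n → ℂ_[p]} (hx : x ∈ X) : IsZeroLocusGerm {h | x + h ∈ X} := by
  obtain ⟨c, hc, F, hF, hXF⟩ := hX x hx
  refine ⟨F.card, fun j h => evalAround (F.equivFin.symm j).1 x (x + h), fun j =>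
    isAnalyticGerm_evalAround hc (hF _ (F.equivFin.symm j).2) x, ?_⟩
  have hbox : ∀ᶠ h in 𝓝 (0 : Fin n → ℂ_[p]), ∀ i, ‖h i‖ ≤ ‖c i‖ := eventually_all.2 fun i => by
    filter_upwards [Metric.closedBall_mem_nhds (0 : Fin n → ℂ_[p]) (norm_pos_iff.2 (hc i))]
      with h hh
    exact (norm_le_pi_norm h i).trans (mem_closedBall_zero_iff.1 hh)
  filter_upwards [hbox] with h hh
  have hmem : x + h ∈ closedBox x fun i => ‖c i‖ := fun i => by simpa using hh i
  have h1 := Set.ext_iff.1 hXF (x + h)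
  simp only [Set.mem_inter_iff, hmem, and_true, Set.mem_ofPred_eq, true_and] at h1
  change x + h ∈ X ↔ _
  rw [h1]
  refine ⟨fun h2 j => h2 _ (F.equivFin.symm j).2, fun h2 f hf => ?_⟩
  simpa using h2 (F.equivFin ⟨f, hf⟩)

/-- The map to dimension 0 shows that each supremum runs over a non-empty set, and pairing with it
bounds that set by `N`. So both suprema are attained, and the hypothesis applies to the maximizers.
-/
theorem dim_add_dim_le {A B : Set (Fin n → ℂ_[p])} (hA : A.Nonempty) (hB : B.Nonempty) {N : ℕ}
    (h : ∀ (a b : ℕ) (l : (Fin n → ℂ_[p]) →ₗ[ℂ_[p]] (Fin a → ℂ_[p]))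
      (l' : (Fin n → ℂ_[p]) →ₗ[ℂ_[p]] (Fin b → ℂ_[p])),
      (interior (l '' A)).Nonempty → (interior (l' '' B)).Nonempty → a + b ≤ N) :
    dim A + dim B ≤ N := by
  classical
  let Q : Set (Fin n → ℂ_[p]) → ℕ → Prop := fun S m =>
    ∃ l : (Fin n → ℂ_[p]) →ₗ[ℂ_[p]] (Fin m → ℂ_[p]), (interior (l '' S)).Nonempty
  have h0 : ∀ S : Set (Fin n → ℂ_[p]), S.Nonempty → Q S 0 := by
    rintro S ⟨s, hs⟩
    refine ⟨0, ?_⟩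
    have : (0 : (Fin n → ℂ_[p]) →ₗ[ℂ_[p]] (Fin 0 → ℂ_[p])) '' S = Set.univ :=
      Set.eq_univ_of_forall fun v => ⟨s, hs, Subsingleton.elim _ _⟩
    rw [this, interior_univ]
    exact Set.univ_nonempty
  have hle : ∀ S, S.Nonempty → (∀ m, Q S m → m ≤ N) → ∃ m, Q S m ∧ dim S ≤ m := by
    intro S hS hb
    refine ⟨Nat.findGreatest (Q S) N, Nat.findGreatest_spec (Nat.zero_le N) (h0 S hS),
      iSup₂_le fun m hm => ?_⟩
    exact_mod_cast Nat.le_findGreatest (hb m hm) hm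
  obtain ⟨a, ⟨l, hl⟩, ha⟩ := hle A hA fun m ⟨l, hl⟩ => by
    obtain ⟨l', hl'⟩ := h0 B hB
    exact h m 0 l l' hl hl'
  obtain ⟨b, ⟨l', hl'⟩, hb⟩ := hle B hB fun m ⟨l, hl⟩ => by
    obtain ⟨l', hl'⟩ := h0 A hA
    exact (Nat.le_add_left _ _).trans (h 0 m l' l hl' hl)
  refine (add_le_add ha hb).trans ?_
  exact_mod_cast h a b l l' hl hl'

theorem le_localDim {X : Set (Fin n → ℂ_[p])} {x : Fin n → ℂ_[p]} {e : ℕ}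
    (y : (Fin n → ℂ_[p]) →ₗ[ℂ_[p]] (Fin e → ℂ_[p]))
    (hy : ∀ U ∈ 𝓝 (0 : Fin n → ℂ_[p]), y '' ({h | x + h ∈ X} ∩ U) ∈ 𝓝 0) :
    (e : WithBot ℕ∞) ≤ localDim X x := by
  refine le_iInf fun c => le_iInf fun r => le_iInf fun hx => ?_
  refine le_iSup₂_of_le e ⟨y, y x, mem_interior_iff_mem_nhds.2 ?_⟩ le_rfl
  have hU : {h | x + h ∈ Metric.ball c r} ∈ 𝓝 (0 : Fin n → ℂ_[p]) :=
    ((continuous_const.add continuous_id).tendsto' 0 x (add_zero x)).eventually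
      (Metric.isOpen_ball.mem_nhds hx)
  have h1 : Tendsto (fun v => v - y x) (𝓝 (y x)) (𝓝 0) :=
    (continuous_id.sub continuous_const).tendsto' _ _ (sub_self _)
  refine Filter.mem_of_superset (h1 (hy _ hU)) ?_
  rintro v ⟨h, ⟨hh, hhU⟩, hv⟩
  exact ⟨x + h, ⟨hh, hhU⟩, by rw [map_add, hv, add_sub_cancel]⟩

/-- The product of two images with interior is an image of the product set with interior, here after
translating `x` to 0. The sup norm makes the ball in the product the product of the balls. -/
theorem add_le_of_interior_nonempty {X Y : Set (Fin n → ℂ_[p])} {x : Fin n → ℂ_[p]} {N : ℕ}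
    {ρ : ℝ} {a b : ℕ} (l : (Fin n → ℂ_[p]) →ₗ[ℂ_[p]] (Fin a → ℂ_[p]))
    (l' : (Fin n → ℂ_[p]) →ₗ[ℂ_[p]] (Fin b → ℂ_[p]))
    (hl : (interior (l '' (X ∩ Metric.ball x ρ))).Nonempty)
    (hl' : (interior (l' '' (Y ∩ Metric.ball x ρ))).Nonempty)
    (h : ∀ m, N < m → ∀ L : (Fin (n + n) → ℂ_[p]) →ₗ[ℂ_[p]] (Fin m → ℂ_[p]),
      interior (L '' ((fstLinear ℂ_[p] n n ⁻¹' {h | x + h ∈ X} ∩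
        sndLinear ℂ_[p] n n ⁻¹' {h | x + h ∈ Y}) ∩ Metric.ball 0 ρ)) = ∅) : a + b ≤ N := by
  by_contra! hlt
  obtain ⟨u, hu⟩ := hl
  obtain ⟨v, hv⟩ := hl'
  refine Set.notMem_empty (Fin.append (u - l x) (v - l' x)) ?_
  rw [← h _ hlt (appendLinear (l.comp (fstLinear ℂ_[p] n n)) (l'.comp (sndLinear ℂ_[p] n n))),
    mem_interior_iff_mem_nhds]
  have h1 : Tendsto (fun w => fstLinear ℂ_[p] a b w + l x)
      (𝓝 (Fin.append (u - l x) (v - l' x))) (𝓝 u) :=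
    ((fstLinear ℂ_[p] a b).continuous_on_pi.add continuous_const).tendsto' _ _
      (by rw [Pi.add_apply, fstLinear_append, sub_add_cancel])
  have h2 : Tendsto (fun w => sndLinear ℂ_[p] a b w + l' x)
      (𝓝 (Fin.append (u - l x) (v - l' x))) (𝓝 v) :=
    ((sndLinear ℂ_[p] a b).continuous_on_pi.add continuous_const).tendsto' _ _
      (by rw [Pi.add_apply, sndLinear_append, sub_add_cancel])
  filter_upwards [h1 (mem_interior_iff_mem_nhds.1 hu), h2 (mem_interior_iff_mem_nhds.1 hv)]
    with w hw hw'
  obtain ⟨s, ⟨hsX, hsb⟩, hs⟩ := hw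
  obtain ⟨t, ⟨htY, htb⟩, ht⟩ := hw'
  rw [mem_ball_iff_norm] at hsb htb
  refine ⟨Fin.append (s - x) (t - x), ⟨⟨?_, ?_⟩, ?_⟩, ?_⟩
  · rw [Set.mem_preimage, fstLinear_append, Set.mem_ofPred_eq, add_sub_cancel]
    exact hsX
  · rw [Set.mem_preimage, sndLinear_append, Set.mem_ofPred_eq, add_sub_cancel]
    exact htY
  · rw [mem_ball_zero_iff, pi_norm_lt_iff ((norm_nonneg _).trans_lt hsb)]
    refine Fin.addCases (fun i => ?_) fun i => ?_
    · rw [Fin.append_left]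
      exact (norm_le_pi_norm (s - x) i).trans_lt hsb
    · rw [Fin.append_right]
      exact (norm_le_pi_norm (t - x) i).trans_lt htb
  · rw [appendLinear_apply, LinearMap.comp_apply, LinearMap.comp_apply, fstLinear_append,
      sndLinear_append, map_sub, map_sub, hs, ht, add_sub_cancel_right, add_sub_cancel_right,
      append_fstLinear_sndLinear]

theorem localDim_add_localDim_le {X Y : Set (Fin n → ℂ_[p])} (hX : IsAnalytic X)
    (hY : IsAnalytic Y) {x : Fin n → ℂ_[p]} (hx : x ∈ X ∩ Y) :
    localDim X x + localDim Y x ≤ localDim (X ∩ Y) x + (n : WithBot ℕ∞) := by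
  have hXg := hX.isZeroLocusGerm hx.1
  have hYg := hY.isZeroLocusGerm hx.2
  obtain ⟨e, y, hiso, hopen⟩ := (hXg.inter hYg).exists_finite_open_projection
    ⟨by simpa using hx.1, by simpa using hx.2⟩
  have he : (e : WithBot ℕ∞) ≤ localDim (X ∩ Y) x := le_localDim y hopen
  set fst := fstLinear ℂ_[p] n n with hfst
  set snd := sndLinear ℂ_[p] n n with hsnd
  have hZ := (hXg.preimage fst).inter (hYg.preimage snd)
  -- Reduction to the diagonal: where `fst - snd` vanishes, a point of the product is a point of X ∩
  -- Y taken twice, and there `y` has an isolated zero.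
  obtain ⟨U, hU, hUdim⟩ := hZ.exists_interior_image_eq_empty
    (appendLinear (y.comp fst) (fst - snd)) (by
      have ht : Tendsto fst (𝓝 0) (𝓝 0) := fst.continuous_on_pi.tendsto' 0 0 (map_zero fst)
      filter_upwards [ht.eventually hiso] with w hw hwZ hyw
      have h1 : y (fst w) = 0 := by
        have := congrArg (fstLinear ℂ_[p] e n) hyw
        rwa [appendLinear_apply, fstLinear_append, map_zero] at this
      have h2 : fst w = snd w := by
        have := congrArg (sndLinear ℂ_[p] e n) hyw
        rwa [appendLinear_apply, sndLinear_append, map_zero, LinearMap.sub_apply,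
          sub_eq_zero] at this
      have h3 : fst w = 0 := hw ⟨hwZ.1, by rw [h2]; exact hwZ.2⟩ h1
      rw [← append_fstLinear_sndLinear w, ← hfst, ← hsnd, ← h2, h3]
      exact funext (Fin.addCases (fun j => Fin.append_left _ _ j) fun j => Fin.append_right _ _ j))
  obtain ⟨ρ, hρ, hball⟩ := Metric.mem_nhds_iff.1 hU
  have hxb : x ∈ Metric.ball x ρ := Metric.mem_ball_self hρ
  have hdim : dim (X ∩ Metric.ball x ρ) + dim (Y ∩ Metric.ball x ρ)
      ≤ ((e + n : ℕ) : WithBot ℕ∞) :=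
    dim_add_dim_le (A := X ∩ Metric.ball x ρ) (B := Y ∩ Metric.ball x ρ) ⟨x, hx.1, hxb⟩
      ⟨x, hx.2, hxb⟩ fun a b l l' hl hl' => add_le_of_interior_nonempty l l' hl hl' fun m hm L =>
        Set.subset_empty_iff.1 ((interior_mono (Set.image_mono
          (Set.inter_subset_inter_right _ hball))).trans (hUdim m hm L).subset)
  calc localDim X x + localDim Y x
      ≤ dim (X ∩ Metric.ball x ρ) + dim (Y ∩ Metric.ball x ρ) := by
        refine add_le_add ?_ ?_
        · exact iInf_le_of_le x (iInf_le_of_le ρ (iInf_le _ hxb))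
        · exact iInf_le_of_le x (iInf_le_of_le ρ (iInf_le _ hxb))
    _ ≤ ((e + n : ℕ) : WithBot ℕ∞) := hdim
    _ = (e : WithBot ℕ∞) + (n : WithBot ℕ∞) := by push_cast; rfl
    _ ≤ _ := add_le_add he le_rfl

end PadicAnalytic

theorem mainTheorem11 (p : ℕ) [Fact p.Prime] (n : ℕ) (X Y : Set (Fin n → ℂ_[p]))
    (hX : PadicAnalytic.IsAnalytic X) (hY : PadicAnalytic.IsAnalytic Y)
    (x : Fin n → ℂ_[p]) (hx : x ∈ X ∩ Y) :
    (PadicAnalytic.localDim X x + PadicAnalytic.localDim Y x ≤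
      PadicAnalytic.localDim (X ∩ Y) x + (n : WithBot ℕ∞)) ∧
    (PadicAnalytic.localDim X x = PadicAnalytic.dim X →
      PadicAnalytic.localDim Y x = PadicAnalytic.dim Y →
      PadicAnalytic.dim X + PadicAnalytic.dim Y ≤
        PadicAnalytic.localDim (X ∩ Y) x + (n : WithBot ℕ∞)) := by
  have h := PadicAnalytic.localDim_add_localDim_le hX hY hx
  exact ⟨h, fun h1 h2 => by rwa [h1, h2] at h⟩
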